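/- Let $\mathbb K$ be a field of characteristic $0$. **2-term Leibniz infinity algebras.** A 2-term Leibniz infinity algebra is a graded vector space $V=V_0\oplus V_1$ with a linear, a bilinear and a trilinear map $l_1,l_2,l_3$ on $V$ of degrees $-1,0,1$ such that, for $w,x,y,z\in V_0$ and $h,k\in V_1$: $l_1l_2(x,h)=l_2(x,l_1h)$, $l_1l_2(h,x)=l_2(l_1h,x)$; $l_2(l_1h,k)=l_2(h,l_1k)$; $l_1l_3(x,y,z)=J(x,y,z)$, $l_3(x,y,l_1h)=J(x,y,h)$, $l_3(x,l_1h,y)=J(x,h,y)$, $l_3(l_1h,x,y)=J(h,x,y)$, where $J(a,b,c)=l_2(a,l_2(b,c))-l_2(b,l_2(a,c))-l_2(l_2(a,b),c)$; and $$l_2(l_3(w,x,y),z)+l_2(w,l_3(x,y,z))-l_2(x,l_3(w,y,z))+l_2(y,l_3(w,x,z))-l_3(l_2(w,x),y,z)+l_3(w,l_2(x,y),z)-l_3(x,l_2(w,y),z)-l_3(w,x,l_2(y,z))+l_3(w,y,l_2(x,z))-l_3(x,y,l_2(w,z))=0.$$ An infinity morphism $f=(f_1,f_2)$ from $(V,l_i)$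 to $(W,m_i)$ is a linear map $f_1$ and a bilinear map $f_2$ from $V$ to $W$ of degrees $0$ and $1$ with $m_1f_1h=f_1l_1h$; $m_2(f_1x,f_1y)+m_1f_2(x,y)=f_1l_2(x,y)$; $m_2(f_1x,f_1h)=f_1l_2(x,h)-f_2(x,l_1h)$; $m_2(f_1h,f_1x)=f_1l_2(h,x)-f_2(l_1h,x)$; and $$m_3(f_1x,f_1y,f_1z)-m_2(f_2(x,y),f_1z)+m_2(f_1x,f_2(y,z))-m_2(f_1y,f_2(x,z))=f_1l_3(x,y,z)+f_2(l_2(x,y),z)-f_2(x,l_2(y,z))+f_2(y,l_2(x,z)).$$ **2-term $\infty$-homotopies.** A 2-term $\infty$-homotopy from $f$ to $g$ (infinity morphisms $V\to W$) is a linear map $\theta_1:V\to W$ of degree $1$ such that, for $x,y\in V_0$, $h\in V_1$: (a) $g_1x-f_1x=m_1\theta_1x$; (b) $g_1h-f_1h=\theta_1l_1h$; (c) $g_2(x,y)-f_2(x,y)=\theta_1l_2(x,y)-m_2(f_1x,\theta_1y)-m_2(\theta_1x,g_1y)$. Let $\mathcal T(f,g)$ be the set of these and $\mathcal T=\bigsqcup_{f,g}\mathcal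 T(f,g)$. **$\infty$-homotopies.** Let $\mathrm{Zin}^c(sV)$ be the reduced tensor module of $sV$ with the Zinbiel coproduct $\Delta(v_1\cdots v_p)=\sum_{k=1}^{p-1}\sum_{\sigma\in \mathrm{Sh}(k,p-k-1)}\varepsilon(\sigma)\,v_{\sigma(1)}\cdots v_{\sigma(k)}\otimes v_{\sigma(k+1)}\cdots v_{\sigma(p-1)}v_p$, and with the coderivation $D$ of degree $-1$ whose corestrictions $D_i$ are given by $l_i=s^{-1}D_is^{\otimes i}$. The convolution Lie infinity algebra $L=L(V,W)=\mathrm{Hom}_{\mathbb K}(\mathrm{Zin}^c(sV),W)$ has the brackets $\mathcal L_1f=m_1f+(-1)^{|f|}fD$ and, for $p\ge2$, $\mathcal L_p(f_1,\dots,f_p)=m_p\circ\big(\sum_{\sigma\in S_p}\varepsilon(\sigma)\,\mathrm{sign}(\sigma)\,f_{\sigma(1)}\otimes\cdots\otimes f_{\sigma(p)}\big)\circ\Delta^{p-1}$, where $\Delta^{p-1}=(\Delta\otimes\mathrm{id}^{\otimes(p-2)})\cdots(\Delta\otimes\mathrm{id})\Delta$ (these brackets vanish for $p\ge4$). Let $\Omega_1=\mathbb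 K[t]\oplus\mathbb K[t]\,dt$ be the algebra of polynomial differential forms on $\Delta^1$, with forms negatively graded, and extend the brackets to $\bar L=L\otimes\Omega_1$: $\bar{\mathcal L}_1(f\otimes\omega)=\mathcal L_1f\otimes\omega+(-1)^{|f|}f\otimes d\omega$ and $\bar{\mathcal L}_p(f_1\otimes\omega_1,\dots,f_p\otimes\omega_p)=\pm\mathcal L_p(f_1,\dots,f_p)\otimes\omega_1\cdots\omega_p$, with the Koszul sign. An $\infty$-homotopy is an element $\alpha\in\bar L$ of degree $-1$ with $\sum_{p\ge1}\frac1{p!}(-1)^{p(p-1)/2}\bar{\mathcal L}_p(\alpha,\dots,\alpha)=0$. Let $\mathcal I$ be the set of these. For $i\in\{0,1\}$ let $\varepsilon_1^i:\bar L\to L$ be the evaluation at $t=i$. An infinity morphism $f$ is identified with the element of degree $-1$ of $L$ with components $f_1s^{-1}$ and $f_2(s\otimes s)^{-1}$ on words of length $1$ and $2$ and $0$ on longer words; let $\mathcal I(f,g)=\{\alpha\in\mathcal I:\varepsilon_1^0\alpha=f,\ \varepsilon_1^1\alpha=g\}$. Finally let $h_1^i:\bar L\to\bar L$ be the (Koszul-signed)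 extension of the operator on $\Omega_1$ that sends $a(t)+b(t)\,dt$ to $\int_i^tb(u)\,du$. **Theorem.** Let $V,W$ be 2-term Leibniz infinity algebras over $\mathbb K$ and let $i\in\{0,1\}$. Every $\alpha\in\mathcal I$ belongs to $\mathcal I(f,g)$ for unique infinity morphisms $f,g:V\to W$, and then, with $\beta=h_1^i\alpha$, the map $$S_1^i\alpha:=(\varepsilon_1^1\beta-\varepsilon_1^0\beta)\,s:V\to W$$ is a 2-term $\infty$-homotopy from $f$ to $g$. The resulting map $S_1^i:\mathcal I\to\mathcal T$ is surjective and preserves source and target: for all $f,g$ it restricts to a surjection $\mathcal I(f,g)\to\mathcal T(f,g)$. -/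

import Mathlib

open scoped TensorProduct Polynomial

namespace LeibInf

noncomputable section

/-! ### 2-term Leibniz infinity algebras, their morphisms and their 2-term homotopies -/

/-- A 2-term Leibniz infinity algebra on the graded vector space `V₀ ⊕ V₁`. The bilinear map of
degree `0` has the components `l₂ : V₀ × V₀ → V₀`, `l₂r : V₀ × V₁ → V₁`, `l₂l : V₁ × V₀ → V₁`
(its component on `V₁ × V₁` takes values in degree `2`, hence vanishes). -/
structure TwoTermLeibniz (K V₀ V₁ : Type*) [Field K] [AddCommGroup V₀] [Module K V₀]
    [AddCommGroup V₁] [Module K V₁] where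
  l₁ : V₁ →ₗ[K] V₀
  l₂ : V₀ →ₗ[K] V₀ →ₗ[K] V₀
  l₂r : V₀ →ₗ[K] V₁ →ₗ[K] V₁
  l₂l : V₁ →ₗ[K] V₀ →ₗ[K] V₁
  l₃ : V₀ →ₗ[K] V₀ →ₗ[K] V₀ →ₗ[K] V₁
  rel_a₁ : ∀ x h, l₁ (l₂r x h) = l₂ x (l₁ h)
  rel_a₂ : ∀ h x, l₁ (l₂l h x) = l₂ (l₁ h) x
  rel_b : ∀ h k, l₂r (l₁ h) k = l₂l h (l₁ k)
  rel_c : ∀ x y z, l₁ (l₃ x y z) = l₂ x (l₂ y z) - l₂ y (l₂ x z) - l₂ (l₂ x y) z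
  rel_d₁ : ∀ x y h, l₃ x y (l₁ h) = l₂r x (l₂r y h) - l₂r y (l₂r x h) - l₂r (l₂ x y) h
  rel_d₂ : ∀ x h y, l₃ x (l₁ h) y = l₂r x (l₂l h y) - l₂l h (l₂ x y) - l₂l (l₂r x h) y
  rel_d₃ : ∀ h x y, l₃ (l₁ h) x y = l₂l h (l₂ x y) - l₂r x (l₂l h y) - l₂l (l₂l h x) y
  rel_e : ∀ w x y z,
    l₂l (l₃ w x y) z + l₂r w (l₃ x y z) - l₂r x (l₃ w y z) + l₂r y (l₃ w x z)
      - l₃ (l₂ w x) y z + l₃ w (l₂ x y) z - l₃ x (l₂ w y) z - l₃ w x (l₂ y z)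
      + l₃ w y (l₂ x z) - l₃ x y (l₂ w z) = 0

section Spaces

variable {K V₀ V₁ W₀ W₁ : Type*} [Field K]
  [AddCommGroup V₀] [Module K V₀] [AddCommGroup V₁] [Module K V₁]
  [AddCommGroup W₀] [Module K W₀] [AddCommGroup W₁] [Module K W₁]

/-- An infinity morphism `(f₁, f₂)` between 2-term Leibniz infinity algebras; `f₁` has the
components `f₁₀ : V₀ → W₀` and `f₁₁ : V₁ → W₁`, and `f₂ : V₀ × V₀ → W₁`. -/
structure InfMorphism (V : TwoTermLeibniz K V₀ V₁) (W : TwoTermLeibniz K W₀ W₁) where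
  f₁₀ : V₀ →ₗ[K] W₀
  f₁₁ : V₁ →ₗ[K] W₁
  f₂ : V₀ →ₗ[K] V₀ →ₗ[K] W₁
  rel_a : ∀ h, W.l₁ (f₁₁ h) = f₁₀ (V.l₁ h)
  rel_b : ∀ x y, W.l₂ (f₁₀ x) (f₁₀ y) + W.l₁ (f₂ x y) = f₁₀ (V.l₂ x y)
  rel_c₁ : ∀ x h, W.l₂r (f₁₀ x) (f₁₁ h) = f₁₁ (V.l₂r x h) - f₂ x (V.l₁ h)
  rel_c₂ : ∀ h x, W.l₂l (f₁₁ h) (f₁₀ x) = f₁₁ (V.l₂l h x) - f₂ (V.l₁ h) x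
  rel_d : ∀ x y z,
    W.l₃ (f₁₀ x) (f₁₀ y) (f₁₀ z) - W.l₂l (f₂ x y) (f₁₀ z) + W.l₂r (f₁₀ x) (f₂ y z)
        - W.l₂r (f₁₀ y) (f₂ x z)
      = f₁₁ (V.l₃ x y z) + f₂ (V.l₂ x y) z - f₂ x (V.l₂ y z) + f₂ y (V.l₂ x z)

/-- A 2-term infinity homotopy, with its source `f` and its target `g`. A linear map of degree `1`
from `V₀ ⊕ V₁` to `W₀ ⊕ W₁` is the same as a linear map `V₀ → W₁`. -/
structure TwoTermHomotopy (V : TwoTermLeibniz K V₀ V₁) (W : TwoTermLeibniz K W₀ W₁) where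
  f : InfMorphism V W
  g : InfMorphism V W
  θ : V₀ →ₗ[K] W₁
  rel_a : ∀ x, g.f₁₀ x - f.f₁₀ x = W.l₁ (θ x)
  rel_b : ∀ h, g.f₁₁ h - f.f₁₁ h = θ (V.l₁ h)
  rel_c : ∀ x y, g.f₂ x y - f.f₂ x y
    = θ (V.l₂ x y) - W.l₂r (f.f₁₀ x) (θ y) - W.l₂l (θ x) (g.f₁₀ y)

end Spaces

/-! ### Primitive recursion on words -/

section Rec

variable {K M X : Type*} [Field K] [AddCommGroup M] [Module K M] [AddCommGroup X] [Module K X]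

/-- Auxiliary to `tRec`: the action of a letter on pairs (word, value). -/
def stepEnd (s : M →ₗ[K] (TensorAlgebra K M × X →ₗ[K] X)) :
    M →ₗ[K] Module.End K (TensorAlgebra K M × X) :=
  LinearMap.mk₂ K (fun v p => (TensorAlgebra.ι K v * p.1, s v p))
    (by intros; simp [add_mul]) (by intros; simp) (by intros; simp [mul_add]) (by intros; simp)

/-- The linear map `F` on the tensor algebra with `F 1 = x₀` and `F (v w) = s v (w, F w)` for a
letter `v` and a word `w`. -/
def tRec (x₀ : X) (s : M →ₗ[K] (TensorAlgebra K M × X →ₗ[K] X)) : TensorAlgebra K M →ₗ[K] X :=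
  LinearMap.snd K _ _ ∘ₗ LinearMap.applyₗ (R := K) ((1 : TensorAlgebra K M), x₀) ∘ₗ
    (TensorAlgebra.lift K (stepEnd s)).toLinearMap

theorem stepEnd_fst (s : M →ₗ[K] (TensorAlgebra K M × X →ₗ[K] X)) (a : TensorAlgebra K M)
    (p : TensorAlgebra K M × X) : (TensorAlgebra.lift K (stepEnd s) a p).1 = a * p.1 := by
  induction a using TensorAlgebra.induction generalizing p with
  | algebraMap r => simp [Algebra.smul_def, Module.algebraMap_end_apply]
  | ι x => simp [stepEnd]
  | mul a b ha hb => simp [ha, hb, mul_assoc]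
  | add a b ha hb => simp [ha, hb, add_mul]

theorem tRec_one (x₀ : X) (s : M →ₗ[K] (TensorAlgebra K M × X →ₗ[K] X)) :
    tRec x₀ s 1 = x₀ := by
  simp [tRec]

theorem tRec_ι_mul (x₀ : X) (s : M →ₗ[K] (TensorAlgebra K M × X →ₗ[K] X)) (v : M)
    (w : TensorAlgebra K M) : tRec x₀ s (TensorAlgebra.ι K v * w) = s v (w, tRec x₀ s w) := by
  have h := stepEnd_fst s w (1, x₀)
  simp only [mul_one] at h
  simp only [tRec, LinearMap.comp_apply, AlgHom.toLinearMap_apply, map_mul, Module.End.mul_apply,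
    LinearMap.applyₗ_apply_apply, TensorAlgebra.lift_ι_apply]
  conv_lhs => rw [stepEnd, LinearMap.mk₂_apply]
  simp only [LinearMap.snd_apply]
  congr 1
  exact Prod.ext h rfl

end Rec

/-! ### The cofree Zinbiel coalgebra on `sV` -/

section Zinbiel

variable (K V₀ V₁ : Type*) [Field K] [AddCommGroup V₀] [Module K V₀] [AddCommGroup V₁] [Module K V₁]

/-- The tensor module `T(sV)`, `V = V₀ ⊕ V₁`; the letter `ι (x, h)` is the suspended vector
`s(x + h)`, so that `ι (x, 0)` has degree `1` and `ι (0, h)` has degree `2`. The space underlying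
`Zin^c(sV)` is its subspace spanned by the nonempty words. All structure maps below are extended by
`0` to the empty word `1`. -/
abbrev Tens := TensorAlgebra K (V₀ × V₁)

variable {K V₀ V₁}

/-- The letter of `sV` given by a homogeneous vector of `V`. -/
def letter : V₀ ⊕ V₁ → Tens K V₀ V₁
  | .inl x => TensorAlgebra.ι K (x, 0)
  | .inr h => TensorAlgebra.ι K (0, h)

/-- The word in `T(sV)` given by a list of homogeneous vectors of `V`. -/
def word (l : List (V₀ ⊕ V₁)) : Tens K V₀ V₁ := (l.map letter).prod

/-- The degree of a homogeneous letter of `sV`. -/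
def letterDeg : V₀ ⊕ V₁ → ℤ
  | .inl _ => 1
  | .inr _ => 2

/-- The degree of a word in homogeneous letters of `sV`. -/
def wordDeg (l : List (V₀ ⊕ V₁)) : ℤ := (l.map letterDeg).sum

/-- The Koszul sign operator `w ↦ (-1)^(k|w|) w` on `T(sV)`. -/
def koszul (k : ℤ) : Tens K V₀ V₁ →ₐ[K] Tens K V₀ V₁ :=
  TensorAlgebra.lift K (TensorAlgebra.ι K ∘ₗ
    LinearMap.prodMap (((-1 : K) ^ k) • LinearMap.id) LinearMap.id)

/-- The projection of `T(sV)` onto the span of the nonempty words. -/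
def red : Tens K V₀ V₁ →ₗ[K] Tens K V₀ V₁ :=
  LinearMap.id - Algebra.linearMap K _ ∘ₗ TensorAlgebra.algebraMapInv.toLinearMap

/-- The Zinbiel coproduct `Δ` of `Zin^c(sV)`,
`Δ(v₁…v_p) = ∑_{1 ≤ k < p} ∑_{σ ∈ Sh(k,p-k-1)} ε(σ) v_{σ(1)}…v_{σ(k)} ⊗ v_{σ(k+1)}…v_{σ(p-1)} v_p`,
written as a recursion on the first letter: for a nonempty word `w`,
`Δ(v w) = v ⊗ w + (v ⊗ 1) Δ(w) + (1 ⊗ v) Δ(w)`, where `(1 ⊗ v)(a ⊗ b) = (-1)^(|v||a|) a ⊗ v b`. -/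
def coprod : Tens K V₀ V₁ →ₗ[K] Tens K V₀ V₁ ⊗[K] Tens K V₀ V₁ :=
  tRec 0 (LinearMap.mk₂ K
    (fun v p => TensorAlgebra.ι K v ⊗ₜ[K] red p.1
      + TensorProduct.map (LinearMap.mul K _ (TensorAlgebra.ι K v)) LinearMap.id p.2
      + TensorProduct.map (koszul 1).toLinearMap
          (LinearMap.mul K _ (TensorAlgebra.ι K (LinearMap.inl K V₀ V₁ v.1))) p.2
      + TensorProduct.map LinearMap.id
          (LinearMap.mul K _ (TensorAlgebra.ι K (LinearMap.inr K V₀ V₁ v.2))) p.2)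
    (by
      intro u v p
      simp only [map_add, Prod.fst_add, Prod.snd_add, TensorProduct.add_tmul,
        TensorProduct.map_add_left, TensorProduct.map_add_right, LinearMap.add_apply]
      abel)
    (by
      intro c v p
      simp only [map_smul, Prod.smul_fst, Prod.smul_snd, TensorProduct.smul_tmul',
        TensorProduct.map_smul_left, TensorProduct.map_smul_right, LinearMap.smul_apply, smul_add])
    (by
      intro v p q
      simp only [map_add, Prod.fst_add, Prod.snd_add, TensorProduct.tmul_add]
      abel)
    (by
      intro c v p
      simp only [map_smul, Prod.smul_fst, Prod.smul_snd, TensorProduct.tmul_smul, smul_add]))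

/-- The coproduct `Δ` with the additional terms `1 ⊗ w`, `w` a nonempty word, i.e. the same sum with
`0 ≤ k < p`. -/
def coprodPlus : Tens K V₀ V₁ →ₗ[K] Tens K V₀ V₁ ⊗[K] Tens K V₀ V₁ :=
  coprod + TensorProduct.mk K _ _ 1 ∘ₗ red

/-- Deconcatenation `v₁…v_n ↦ ∑_{0 ≤ k ≤ n} v₁…v_k ⊗ v_{k+1}…v_n`. -/
def deconc : Tens K V₀ V₁ →ₗ[K] Tens K V₀ V₁ ⊗[K] Tens K V₀ V₁ :=
  tRec (1 ⊗ₜ[K] 1) (LinearMap.mk₂ K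
    (fun v p => 1 ⊗ₜ[K] (TensorAlgebra.ι K v * p.1)
      + TensorProduct.map (LinearMap.mul K _ (TensorAlgebra.ι K v)) LinearMap.id p.2)
    (by
      intro u v p
      simp only [map_add, add_mul, TensorProduct.tmul_add, TensorProduct.map_add_left,
        LinearMap.add_apply]
      abel)
    (by
      intro c v p
      simp only [map_smul, smul_mul_assoc, TensorProduct.tmul_smul, TensorProduct.map_smul_left,
        LinearMap.smul_apply, smul_add])
    (by
      intro v p q
      simp only [map_add, Prod.fst_add, Prod.snd_add, mul_add, TensorProduct.tmul_add]
      abel)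
    (by
      intro c v p
      simp only [map_smul, Prod.smul_fst, Prod.smul_snd, mul_smul_comm, TensorProduct.tmul_smul,
        smul_add]))

/-- The projection of `T(sV)` onto words of length `1`. -/
def proj₁ : Tens K V₀ V₁ →ₗ[K] V₀ × V₁ :=
  tRec 0 (LinearMap.mk₂ K (fun v p => TensorAlgebra.algebraMapInv p.1 • v)
    (by intros; simp) (by intro c v p; exact smul_comm _ _ _) (by intros; simp [add_smul])
    (by intros; simp [mul_smul]))

/-- The projection of `T(sV)` onto words of length `2`. -/
def proj₂ : Tens K V₀ V₁ →ₗ[K] (V₀ × V₁) ⊗[K] (V₀ × V₁) :=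
  tRec 0 (LinearMap.mk₂ K (fun v p => v ⊗ₜ[K] proj₁ p.1)
    (by intros; simp [TensorProduct.add_tmul]) (by intros; simp [TensorProduct.smul_tmul'])
    (by intros; simp [TensorProduct.tmul_add]) (by intros; simp))

/-- The projection of `T(sV)` onto words of length `3`. -/
def proj₃ : Tens K V₀ V₁ →ₗ[K] (V₀ × V₁) ⊗[K] ((V₀ × V₁) ⊗[K] (V₀ × V₁)) :=
  tRec 0 (LinearMap.mk₂ K (fun v p => v ⊗ₜ[K] proj₂ p.1)
    (by intros; simp [TensorProduct.add_tmul]) (by intros; simp [TensorProduct.smul_tmul'])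
    (by intros; simp [TensorProduct.tmul_add]) (by intros; simp))

/-- The operator `v ↦ (-1)^|v| v` on `V = V₀ ⊕ V₁`. -/
def parity : V₀ × V₁ →ₗ[K] V₀ × V₁ := LinearMap.prodMap LinearMap.id (-LinearMap.id)

/-- The homogeneous component of degree `n` of `V = V₀ ⊕ V₁`. -/
def gr (K V₀ V₁ : Type*) [Field K] [AddCommGroup V₀] [Module K V₀] [AddCommGroup V₁] [Module K V₁]
    (n : ℤ) : Submodule K (V₀ × V₁) where
  carrier := {v | (n ≠ 0 → v.1 = 0) ∧ (n ≠ 1 → v.2 = 0)}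
  add_mem' := by
    rintro a b ⟨h₁, h₂⟩ ⟨h₃, h₄⟩
    exact ⟨fun h => by simp [h₁ h, h₃ h], fun h => by simp [h₂ h, h₄ h]⟩
  zero_mem' := by simp
  smul_mem' := by
    rintro c a ⟨h₁, h₂⟩
    exact ⟨fun h => by simp [h₁ h], fun h => by simp [h₂ h]⟩

namespace TwoTermLeibniz

variable (V : TwoTermLeibniz K V₀ V₁)

/-- The structure map `l₁` on `V = V₀ ⊕ V₁`. -/
def t₁ : V₀ × V₁ →ₗ[K] V₀ × V₁ := LinearMap.inl K V₀ V₁ ∘ₗ V.l₁ ∘ₗ LinearMap.snd K V₀ V₁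

/-- The structure map `l₂` on `V = V₀ ⊕ V₁`. -/
def t₂ : (V₀ × V₁) ⊗[K] (V₀ × V₁) →ₗ[K] V₀ × V₁ :=
  TensorProduct.lift (LinearMap.mk₂ K
    (fun u v => (V.l₂ u.1 v.1, V.l₂r u.1 v.2 + V.l₂l u.2 v.1))
    (by intros; simp; abel) (by intros; simp) (by intros; simp; abel) (by intros; simp))

/-- The structure map `l₃` on `V = V₀ ⊕ V₁`. -/
def t₃ : (V₀ × V₁) ⊗[K] ((V₀ × V₁) ⊗[K] (V₀ × V₁)) →ₗ[K] V₀ × V₁ :=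
  LinearMap.inr K V₀ V₁ ∘ₗ
    TensorProduct.lift (TensorProduct.uncurry (RingHom.id K) V₀ V₀ V₁ ∘ₗ V.l₃) ∘ₗ
    TensorProduct.map (LinearMap.fst K V₀ V₁)
      (TensorProduct.map (LinearMap.fst K V₀ V₁) (LinearMap.fst K V₀ V₁))

/-- The corestriction `D₁ + D₂ + D₃ : Zin^c(sV) → sV` of the codifferential, where
`l_i = s⁻¹ D_i s^{⊗ i}`, i.e. `D₁(su) = s l₁(u)`, `D₂(su, sv) = (-1)^|u| s l₂(u, v)` and
`D₃(su, sv, sw) = (-1)^|v| s l₃(u, v, w)` (where `l₃` vanishes unless `|v| = 0`). -/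
def corestr : Tens K V₀ V₁ →ₗ[K] V₀ × V₁ :=
  V.t₁ ∘ₗ proj₁ + V.t₂ ∘ₗ TensorProduct.map parity LinearMap.id ∘ₗ proj₂ + V.t₃ ∘ₗ proj₃

/-- The codifferential of `Zin^c(sV)`, i.e. the coderivation of degree `-1` with the given
corestriction:
`D(v₁…v_n) = ∑_k ∑_j ∑_{σ ∈ Sh(k-j,j-1)} ε(σ) (-1)^{|v_{σ(1)}| + ⋯ + |v_{σ(k-j)}|}
  v_{σ(1)}…v_{σ(k-j)} D_j(v_{σ(k-j+1)},…,v_{σ(k-1)},v_k) v_{k+1}…v_n`. -/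
def codiff : Tens K V₀ V₁ →ₗ[K] Tens K V₀ V₁ :=
  LinearMap.mul' K _ ∘ₗ
    TensorProduct.map
      (LinearMap.mul' K _ ∘ₗ
        TensorProduct.map (koszul (-1)).toLinearMap (TensorAlgebra.ι K ∘ₗ V.corestr) ∘ₗ coprodPlus)
      LinearMap.id ∘ₗ
    deconc

end TwoTermLeibniz

end Zinbiel

/-! ### The convolution Lie infinity algebra `L(V, W) = Hom(Zin^c(sV), W)` -/

section Convolution

variable {K V₀ V₁ W₀ W₁ : Type*} [Field K]
  [AddCommGroup V₀] [Module K V₀] [AddCommGroup V₁] [Module K V₁]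
  [AddCommGroup W₀] [Module K W₀] [AddCommGroup W₁] [Module K W₁]

variable (K V₀ V₁ W₀ W₁) in
/-- Linear maps `T(sV) → W`. -/
abbrev THom := Tens K V₀ V₁ →ₗ[K] W₀ × W₁

variable (K V₀ V₁ W₀ W₁) in
/-- The component `L_k` of degree `k` of `L = Hom(Zin^c(sV), W)`: the linear maps that raise the
degree by `k`. A linear map on `Zin^c(sV)` is identified with the linear map on `T(sV)` that extends
it by `0` to the empty word. -/
def convDeg (k : ℤ) : Submodule K (THom K V₀ V₁ W₀ W₁) where
  carrier := {f | f 1 = 0 ∧ ∀ l : List (V₀ ⊕ V₁), f (word l) ∈ gr K W₀ W₁ (wordDeg l + k)}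
  add_mem' := by
    rintro a b ⟨h₁, h₂⟩ ⟨h₃, h₄⟩
    exact ⟨by simp [h₁, h₃], fun l => Submodule.add_mem _ (h₂ l) (h₄ l)⟩
  zero_mem' := ⟨by simp, fun l => Submodule.zero_mem _⟩
  smul_mem' := by
    rintro c a ⟨h₁, h₂⟩
    exact ⟨by simp [h₁], fun l => Submodule.smul_mem _ c (h₂ l)⟩

/-- `(f₁ ⊗ f₂) ∘ Δ`, for `f₂` of degree `k₂`, where
`(f₁ ⊗ f₂)(a ⊗ b) = (-1)^(k₂|a|) f₁(a) ⊗ f₂(b)`. -/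
def conv₂ (k₂ : ℤ) : THom K V₀ V₁ W₀ W₁ →ₗ[K] THom K V₀ V₁ W₀ W₁ →ₗ[K]
    (Tens K V₀ V₁ →ₗ[K] (W₀ × W₁) ⊗[K] (W₀ × W₁)) :=
  LinearMap.mk₂ K
    (fun f₁ f₂ => TensorProduct.map (f₁ ∘ₗ (koszul k₂).toLinearMap) f₂ ∘ₗ coprod)
    (by intros; simp only [LinearMap.add_comp, TensorProduct.map_add_left])
    (by intros; simp only [LinearMap.smul_comp, TensorProduct.map_smul_left])
    (by intros; simp only [LinearMap.add_comp, TensorProduct.map_add_right])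
    (by intros; simp only [LinearMap.smul_comp, TensorProduct.map_smul_right])

/-- `(f₁ ⊗ f₂ ⊗ f₃) ∘ Δ²`, for `f₂` of degree `k₂` and `f₃` of degree `k₃`, where
`Δ² = (Δ ⊗ id) ∘ Δ` and
`(f₁ ⊗ f₂ ⊗ f₃)(a ⊗ b ⊗ c) = (-1)^(k₂|a| + k₃(|a| + |b|)) f₁(a) ⊗ f₂(b) ⊗ f₃(c)`. -/
def conv₃ (k₂ k₃ : ℤ) : THom K V₀ V₁ W₀ W₁ →ₗ[K] THom K V₀ V₁ W₀ W₁ →ₗ[K]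
    THom K V₀ V₁ W₀ W₁ →ₗ[K]
    (Tens K V₀ V₁ →ₗ[K] (W₀ × W₁) ⊗[K] ((W₀ × W₁) ⊗[K] (W₀ × W₁))) :=
  LinearMap.mk₂ K
    (fun f₁ f₂ =>
      { toFun := fun f₃ => (TensorProduct.assoc K _ _ _).toLinearMap ∘ₗ
          TensorProduct.map (conv₂ k₂ f₁ f₂ ∘ₗ (koszul k₃).toLinearMap) f₃ ∘ₗ coprod
        map_add' := by
          intros
          simp only [LinearMap.add_comp, LinearMap.comp_add, TensorProduct.map_add_right]
        map_smul' := by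
          intros
          simp only [LinearMap.smul_comp, LinearMap.comp_smul, TensorProduct.map_smul_right,
            RingHom.id_apply] })
    (by
      intros; ext1
      simp only [map_add, LinearMap.add_apply, LinearMap.add_comp, LinearMap.comp_add,
        TensorProduct.map_add_left, LinearMap.coe_mk, AddHom.coe_mk])
    (by
      intros; ext1
      simp only [map_smul, LinearMap.smul_apply, LinearMap.smul_comp, LinearMap.comp_smul,
        TensorProduct.map_smul_left, LinearMap.coe_mk, AddHom.coe_mk])
    (by
      intros; ext1
      simp only [map_add, LinearMap.add_apply, LinearMap.add_comp, LinearMap.comp_add,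
        TensorProduct.map_add_left, LinearMap.coe_mk, AddHom.coe_mk])
    (by
      intros; ext1
      simp only [map_smul, LinearMap.smul_apply, LinearMap.smul_comp, LinearMap.comp_smul,
        TensorProduct.map_smul_left, LinearMap.coe_mk, AddHom.coe_mk])

/-- The convolution bracket `𝓛₁ f = m₁ ∘ f + (-1)^k f ∘ D` on elements of degree `k`. -/
def bracket₁ (V : TwoTermLeibniz K V₀ V₁) (W : TwoTermLeibniz K W₀ W₁) (k : ℤ) :
    THom K V₀ V₁ W₀ W₁ →ₗ[K] THom K V₀ V₁ W₀ W₁ :=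
  LinearMap.llcomp K _ _ _ W.t₁ + ((-1 : K) ^ k) • LinearMap.lcomp K _ V.codiff

/-- The sum `∑_σ ε(σ) sign(σ) f_{σ(1)} ⊗ f_{σ(2)} ∘ Δ` over the two permutations `σ`, for elements of
degrees `k₁`, `k₂`. -/
def antisymm₂ (k₁ k₂ : ℤ) : THom K V₀ V₁ W₀ W₁ →ₗ[K] THom K V₀ V₁ W₀ W₁ →ₗ[K]
    (Tens K V₀ V₁ →ₗ[K] (W₀ × W₁) ⊗[K] (W₀ × W₁)) :=
  LinearMap.mk₂ K
    (fun f₁ f₂ => conv₂ k₂ f₁ f₂ - ((-1 : K) ^ (k₁ * k₂)) • conv₂ k₁ f₂ f₁)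
    (by intros; simp only [map_add, LinearMap.add_apply]; module)
    (by intros; simp only [map_smul, LinearMap.smul_apply]; module)
    (by intros; simp only [map_add, LinearMap.add_apply]; module)
    (by intros; simp only [map_smul, LinearMap.smul_apply]; module)

/-- The convolution bracket `𝓛₂ (f₁, f₂) = m₂ ∘ ∑_σ ε(σ) sign(σ) f_{σ(1)} ⊗ f_{σ(2)} ∘ Δ` on elements
of degrees `k₁`, `k₂`. -/
def bracket₂ (W : TwoTermLeibniz K W₀ W₁) (k₁ k₂ : ℤ) :
    THom K V₀ V₁ W₀ W₁ →ₗ[K] THom K V₀ V₁ W₀ W₁ →ₗ[K] THom K V₀ V₁ W₀ W₁ :=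
  (antisymm₂ k₁ k₂).compr₂ (LinearMap.llcomp K _ _ _ W.t₂)

/-- The sum `∑_σ ε(σ) sign(σ) f_{σ(1)} ⊗ f_{σ(2)} ⊗ f_{σ(3)} ∘ Δ²` over the six permutations `σ`, for
elements of degrees `k₁`, `k₂`, `k₃`. -/
def antisymm₃ (k₁ k₂ k₃ : ℤ) : THom K V₀ V₁ W₀ W₁ →ₗ[K] THom K V₀ V₁ W₀ W₁ →ₗ[K]
    THom K V₀ V₁ W₀ W₁ →ₗ[K]
    (Tens K V₀ V₁ →ₗ[K] (W₀ × W₁) ⊗[K] ((W₀ × W₁) ⊗[K] (W₀ × W₁))) :=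
  LinearMap.mk₂ K
    (fun f₁ f₂ =>
      { toFun := fun f₃ => conv₃ k₂ k₃ f₁ f₂ f₃
          - ((-1 : K) ^ (k₁ * k₂)) • conv₃ k₁ k₃ f₂ f₁ f₃
          - ((-1 : K) ^ (k₂ * k₃)) • conv₃ k₃ k₂ f₁ f₃ f₂
          + ((-1 : K) ^ (k₁ * k₂ + k₁ * k₃)) • conv₃ k₃ k₁ f₂ f₃ f₁
          + ((-1 : K) ^ (k₁ * k₃ + k₂ * k₃)) • conv₃ k₁ k₂ f₃ f₁ f₂
          - ((-1 : K) ^ (k₁ * k₂ + k₁ * k₃ + k₂ * k₃)) • conv₃ k₂ k₁ f₃ f₂ f₁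
        map_add' := by
          intros
          simp only [map_add, LinearMap.add_apply]
          module
        map_smul' := by
          intros
          simp only [map_smul, LinearMap.smul_apply, RingHom.id_apply]
          module })
    (by
      intros; ext1
      simp only [map_add, LinearMap.add_apply, LinearMap.coe_mk, AddHom.coe_mk]
      module)
    (by
      intros; ext1
      simp only [map_smul, LinearMap.smul_apply, LinearMap.coe_mk, AddHom.coe_mk]
      module)
    (by
      intros; ext1
      simp only [map_add, LinearMap.add_apply, LinearMap.coe_mk, AddHom.coe_mk]
      module)
    (by
      intros; ext1
      simp only [map_smul, LinearMap.smul_apply, LinearMap.coe_mk, AddHom.coe_mk]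
      module)

/-- The convolution bracket
`𝓛₃ (f₁, f₂, f₃) = m₃ ∘ ∑_σ ε(σ) sign(σ) f_{σ(1)} ⊗ f_{σ(2)} ⊗ f_{σ(3)} ∘ Δ²` on elements of degrees
`k₁`, `k₂`, `k₃`. The brackets `𝓛_p` with `p ≥ 4` vanish since `m_p = 0` for `p ≥ 4`. -/
def bracket₃ (W : TwoTermLeibniz K W₀ W₁) (k₁ k₂ k₃ : ℤ) :
    THom K V₀ V₁ W₀ W₁ →ₗ[K] THom K V₀ V₁ W₀ W₁ →ₗ[K] THom K V₀ V₁ W₀ W₁ →ₗ[K]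
      THom K V₀ V₁ W₀ W₁ :=
  (antisymm₃ k₁ k₂ k₃).compr₂ (LinearMap.llcomp K _ _ _ (LinearMap.llcomp K _ _ _ W.t₃))

/-- The element of degree `-1` of `L(V, W)` that corresponds to an infinity morphism: its components
are `f₁ s⁻¹` on words of length `1` and `f₂ (s ⊗ s)⁻¹` on words of length `2`. -/
def InfMorphism.toL {V : TwoTermLeibniz K V₀ V₁} {W : TwoTermLeibniz K W₀ W₁}
    (f : InfMorphism V W) : THom K V₀ V₁ W₀ W₁ :=
  LinearMap.prodMap f.f₁₀ f.f₁₁ ∘ₗ proj₁ +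
    LinearMap.inr K W₀ W₁ ∘ₗ TensorProduct.lift f.f₂ ∘ₗ
      TensorProduct.map (LinearMap.fst K V₀ V₁) (LinearMap.fst K V₀ V₁) ∘ₗ proj₂

end Convolution

/-! ### Polynomial differential forms on the 1-simplex -/

section Forms

variable (K : Type*) [Field K]

/-- The algebra `Ω₁ = K[t] ⊕ K[t] dt` of polynomial differential forms on the 1-simplex, with
`(dt)² = 0`; `t` is the barycentric coordinate that is `0` at the vertex `e₀` and `1` at the vertex
`e₁`. A form `a + b dt` has the components `fst = a` and `snd = b`. -/
abbrev Forms := DualNumber K[X]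

variable {K}

/-- The component of form degree `j`. -/
def formPr (j : Fin 2) : Forms K →ₗ[K] Forms K where
  toFun ω := if j = 0 then TrivSqZeroExt.inl ω.fst else TrivSqZeroExt.inr ω.snd
  map_add' := by intros; split_ifs <;> simp [add_smul]
  map_smul' := by intros; split_ifs <;> simp

/-- The de Rham differential `a + b dt ↦ a' dt`. -/
def formD : Forms K →ₗ[K] Forms K where
  toFun ω := TrivSqZeroExt.inr (Polynomial.derivative ω.fst)
  map_add' := by intros; simp [add_smul]
  map_smul' := by intros; simp

/-- The evaluation `ε₁ⁱ` of forms at the vertex `e_i`. -/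
def formEval (i : Fin 2) : Forms K →ₗ[K] K where
  toFun ω := ω.fst.eval (i.val : K)
  map_add' := by intros; simp
  map_smul' := by intros; simp

/-- The primitive of a polynomial that vanishes at `0`. -/
def primitive : K[X] →ₗ[K] K[X] :=
  Polynomial.lsum fun n => ((n + 1 : K)⁻¹) • Polynomial.monomial (n + 1)

/-- The homotopy operator `h₁ⁱ ω = ∫_I (φᵢ)^* ω`, with `φᵢ(u, t) = u t + (1 - u) e_i`: it sends
`a + b dt` to the primitive of `b` that vanishes at `e_i`. -/
def formH (i : Fin 2) : Forms K →ₗ[K] Forms K where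
  toFun ω := TrivSqZeroExt.inl
    (primitive ω.snd - Polynomial.C ((primitive ω.snd).eval (i.val : K)))
  map_add' := by
    intros
    simp only [TrivSqZeroExt.snd_add, map_add, Polynomial.eval_add, ← TrivSqZeroExt.inl_add]
    congr 1
    ring
  map_smul' := by
    intros
    simp only [TrivSqZeroExt.snd_smul, map_smul, Polynomial.eval_smul, RingHom.id_apply,
      ← TrivSqZeroExt.inl_smul, smul_sub, Polynomial.smul_C]

end Forms

/-! ### Maurer-Cartan elements of `L(V, W) ⊗ Ω₁` -/

section MaurerCartan

variable {K V₀ V₁ W₀ W₁ : Type*} [Field K]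
  [AddCommGroup V₀] [Module K V₀] [AddCommGroup V₁] [Module K V₁]
  [AddCommGroup W₀] [Module K W₀] [AddCommGroup W₁] [Module K W₁]

variable (K V₀ V₁ W₀ W₁) in
/-- The space that contains `L(V, W) ⊗ Ω₁`. -/
abbrev LForms := THom K V₀ V₁ W₀ W₁ ⊗[K] Forms K

variable (K V₀ V₁ W₀ W₁) in
/-- The component of degree `n` of `L ⊗ Ω₁`, i.e. `L_n ⊗ Ω₁⁰ ⊕ L_{n+1} ⊗ Ω₁¹`: forms are negatively
graded. -/
def totDeg (n : ℤ) : Submodule K (LForms K V₀ V₁ W₀ W₁) :=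
  ⨆ j : Fin 2, Submodule.map₂ (TensorProduct.mk K _ _) (convDeg K V₀ V₁ W₀ W₁ (n + j.val))
    (LinearMap.range (formPr (K := K) j))

/-- The component of form degree `j`. -/
def pr (j : Fin 2) : LForms K V₀ V₁ W₀ W₁ →ₗ[K] LForms K V₀ V₁ W₀ W₁ :=
  TensorProduct.map LinearMap.id (formPr j)

/-- The evaluation `L ⊗ Ω₁ → L` at the vertex `e_i`. -/
def evalAt (i : Fin 2) : LForms K V₀ V₁ W₀ W₁ →ₗ[K] THom K V₀ V₁ W₀ W₁ :=
  (TensorProduct.rid K _).toLinearMap ∘ₗ TensorProduct.map LinearMap.id (formEval i)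

/-- The homotopy operator `h₁ⁱ` on elements of degree `n` of `L ⊗ Ω₁`: as `h₁ⁱ` has degree `1`,
`h₁ⁱ(f ⊗ ω) = (-1)^|f| f ⊗ h₁ⁱ ω`, and `|f| = n + j` if `ω` has form degree `j`. -/
def homotopyOp (i : Fin 2) (n : ℤ) : LForms K V₀ V₁ W₀ W₁ →ₗ[K] LForms K V₀ V₁ W₀ W₁ :=
  ∑ j : Fin 2, ((-1 : K) ^ (n + j.val)) • TensorProduct.map LinearMap.id (formH i) ∘ₗ pr j

/-- The differential of `L ⊗ Ω₁` on elements of degree `n`: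
`f ⊗ ω ↦ 𝓛₁ f ⊗ ω + (-1)^|f| f ⊗ dω`, where `|f| = n + j` if `ω` has form degree `j`. -/
def extBracket₁ (V : TwoTermLeibniz K V₀ V₁) (W : TwoTermLeibniz K W₀ W₁) (n : ℤ)
    (F : LForms K V₀ V₁ W₀ W₁) : LForms K V₀ V₁ W₀ W₁ :=
  ∑ j : Fin 2, (TensorProduct.map (bracket₁ V W (n + j.val)) LinearMap.id (pr j F)
    + ((-1 : K) ^ (n + j.val)) • TensorProduct.map LinearMap.id formD (pr j F))

/-- The bracket `(f₁ ⊗ ω₁, f₂ ⊗ ω₂) ↦ (-1)^(|ω₁||f₂|) 𝓛₂(f₁, f₂) ⊗ ω₁ω₂` of `L ⊗ Ω₁` on elements of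
degrees `n₁`, `n₂`. -/
def extBracket₂ (W : TwoTermLeibniz K W₀ W₁) (n₁ n₂ : ℤ)
    (F₁ F₂ : LForms K V₀ V₁ W₀ W₁) : LForms K V₀ V₁ W₀ W₁ :=
  ∑ j₁ : Fin 2, ∑ j₂ : Fin 2, ((-1 : K) ^ ((j₁.val : ℤ) * (n₂ + j₂.val))) •
    TensorProduct.map₂ (bracket₂ W (n₁ + j₁.val) (n₂ + j₂.val)) (LinearMap.mul K (Forms K))
      (pr j₁ F₁) (pr j₂ F₂)

/-- The bracket
`(f₁ ⊗ ω₁, f₂ ⊗ ω₂, f₃ ⊗ ω₃) ↦ (-1)^(|ω₁|(|f₂| + |f₃|) + |ω₂||f₃|) 𝓛₃(f₁, f₂, f₃) ⊗ ω₁ω₂ω₃` of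
`L ⊗ Ω₁` on elements of degrees `n₁`, `n₂`, `n₃`. -/
def extBracket₃ (W : TwoTermLeibniz K W₀ W₁) (n₁ n₂ n₃ : ℤ)
    (F₁ F₂ F₃ : LForms K V₀ V₁ W₀ W₁) : LForms K V₀ V₁ W₀ W₁ :=
  ∑ j₁ : Fin 2, ∑ j₂ : Fin 2, ∑ j₃ : Fin 2,
    ((-1 : K) ^ ((j₁.val : ℤ) * ((n₂ + j₂.val) + (n₃ + j₃.val)) + j₂.val * (n₃ + j₃.val))) •
    TensorProduct.homTensorHomMap (RingHom.id K) _ _ _ _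
      (TensorProduct.map₂ (bracket₃ W (n₁ + j₁.val) (n₂ + j₂.val) (n₃ + j₃.val))
        ((LinearMap.mul K (Forms K)).compr₂ (LinearMap.mul K (Forms K)))
        (pr j₁ F₁) (pr j₂ F₂))
      (pr j₃ F₃)

/-- The left hand side `∑_p (1/p!) (-1)^(p(p-1)/2) 𝓛_p(α, …, α)` of the Maurer-Cartan equation for an
element `α` of degree `-1` of `L ⊗ Ω₁`. -/
def curvature (V : TwoTermLeibniz K V₀ V₁) (W : TwoTermLeibniz K W₀ W₁)
    (α : LForms K V₀ V₁ W₀ W₁) : LForms K V₀ V₁ W₀ W₁ :=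
  extBracket₁ V W (-1) α - (1 / 2 : K) • extBracket₂ W (-1) (-1) α α
    - (1 / 6 : K) • extBracket₃ W (-1) (-1) (-1) α α α

/-- Infinity homotopies between infinity morphisms from `V` to `W`: the Maurer-Cartan elements of
`L(V, W) ⊗ Ω₁`. -/
structure InfHomotopy (V : TwoTermLeibniz K V₀ V₁) (W : TwoTermLeibniz K W₀ W₁) where
  α : LForms K V₀ V₁ W₀ W₁
  degree : α ∈ totDeg K V₀ V₁ W₀ W₁ (-1)
  maurerCartan : curvature V W α = 0

/-- The infinity homotopies from `f` to `g`. -/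
def infHomotopies {V : TwoTermLeibniz K V₀ V₁} {W : TwoTermLeibniz K W₀ W₁}
    (f g : InfMorphism V W) : Set (InfHomotopy V W) :=
  {a | evalAt 0 a.α = f.toL ∧ evalAt 1 a.α = g.toL}

/-- The 2-term infinity homotopies from `f` to `g`. -/
def twoTermHomotopies {V : TwoTermLeibniz K V₀ V₁} {W : TwoTermLeibniz K W₀ W₁}
    (f g : InfMorphism V W) : Set (TwoTermHomotopy V W) :=
  {a | a.f = f ∧ a.g = g}

/-- The homotopy parameter `(β(1) - β(0)) s : V₀ → W₁` of an element `α` of degree `-1` of `L ⊗ Ω₁`,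
where `β = h₁ⁱ α`. -/
def homotopyParam (i : Fin 2) (α : LForms K V₀ V₁ W₀ W₁) : V₀ →ₗ[K] W₁ :=
  LinearMap.snd K W₀ W₁ ∘ₗ
    (evalAt 1 (homotopyOp i (-1) α) - evalAt 0 (homotopyOp i (-1) α)) ∘ₗ
    TensorAlgebra.ι K ∘ₗ LinearMap.inl K V₀ V₁

end MaurerCartan

end

end LeibInf

namespace LeibInf

/-! ### Words and the recursive structure maps -/

section Words

variable {K M : Type*} [Field K] [AddCommGroup M] [Module K M]

/-! Degrees leave little room. Since `sV` lives in degrees 1 and 2 and `W` in degrees 0 and 1, an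
element of degree -1 of `L` is a triple `(a, b, c)` of maps `V₀ → W₀`, `V₁ → W₁`, `V₀ × V₀ → W₁`
(`eq_ofComponents`), and an element of degree 0 is one map `θ : V₀ → W₁` (`eq_ofParam`). So `α =
F(t) + B(t) dt` is a polynomial family of triples together with a polynomial family of maps `β(t) :
V₀ → W₁`.

The curvature splits by form degree. Its part without `dt` vanishes exactly when every `F(t)` is a
Maurer-Cartan element of `L`, i.e. an infinity morphism (`flatCurvature_ofComponents_eq_zero_iff`).
Its `dt` part is the differential equation `F' = twistedDiff F B`, which reads `a' = m₁β`, `b' =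
βl₁`, `c' = βl₂ - m₂(a, β) - m₂(β, a)` (`twistedDiff_ofComponents_ofParam`).

This system can be integrated in closed form. Let `p` be the primitive of `β` with `p(0) = 0`. Then
`a(t) = a(0) + m₁p(t)` and `b(t) = b(0) + p(t)l₁`. After substitution of `a(t)`, the quadratic terms
of `c'` are `-m₂(m₁p, p') - m₂(p', m₁p)`, and `m₂(m₁h, k) = m₂(h, m₁k)` makes them the derivative of
`-m₂(p, m₁p)`. At `t = 1` the result is precisely (a), (b), (c) with parameter `p(1) = ∫₀¹ β`, which
is the parameter read off from `h₁ⁱα` for either `i`.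

For surjectivity take `β` constant, equal to the given `θ`. The solution is `F(t) = f.transport (t •
θ)`, quadratic in `t`; it consists of infinity morphisms because `transport` preserves the
relations, and it ends at `g` because (a), (b), (c) determine `g` from `f` and `θ`
(`TwoTermHomotopy.transport_eq`).

Homogeneity is handled by the action that multiplies degree `n` by `2^n`: equivariance passes
through the recursive definitions, and in characteristic 0 it recovers the degree. -/

theorem tens_induction {p : TensorAlgebra K M → Prop} (one : p 1)
    (cons : ∀ v w, p w → p (TensorAlgebra.ι K v * w)) (add : ∀ a b, p a → p b → p (a + b))
    (smul : ∀ (c : K) a, p a → p (c • a)) (w : TensorAlgebra K M) : p w := by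
  -- Induction on the algebra meets arbitrary products, while the hypotheses only prepend letters.
  -- The property "left multiplication by `w` preserves `p`" is stable under products.
  suffices h : ∀ b, p b → p (w * b) by simpa using h 1 one
  induction w using TensorAlgebra.induction with
  | algebraMap r => intro b hb; rw [← Algebra.smul_def]; exact smul r b hb
  | ι v => exact fun b hb => cons v b hb
  | mul a b ha hb => intro c hc; rw [mul_assoc]; exact ha _ (hb _ hc)
  | add a b ha hb => intro c hc; rw [add_mul]; exact add _ _ (ha c hc) (hb c hc)

theorem tens_hom_ext {X : Type*} [AddCommGroup X] [Module K X] {F G : TensorAlgebra K M →ₗ[K] X}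
    (one : F 1 = G 1)
    (cons : ∀ v w, F w = G w → F (TensorAlgebra.ι K v * w) = G (TensorAlgebra.ι K v * w)) :
    F = G := by
  ext1 w
  induction w using tens_induction with
  | one => exact one
  | cons v w h => exact cons v w h
  | add a b ha hb => rw [map_add, map_add, ha, hb]
  | smul c a ha => rw [map_smul, map_smul, ha]

end Words

section Zinbiel

variable {K V₀ V₁ : Type*} [Field K] [AddCommGroup V₀] [Module K V₀] [AddCommGroup V₁] [Module K V₁]

theorem word_nil : (word [] : Tens K V₀ V₁) = 1 := by simp [word]

theorem word_cons (a : V₀ ⊕ V₁) (l : List (V₀ ⊕ V₁)) :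
    (word (a :: l) : Tens K V₀ V₁) = letter a * word l := by simp [word]

/-- Every letter is the sum of its homogeneous parts, so words in homogeneous letters span. Gradings
are only stated on such words. -/
theorem tens_hom_ext_word {X : Type*} [AddCommGroup X] [Module K X] {F G : Tens K V₀ V₁ →ₗ[K] X}
    (h : ∀ l, F (word l) = G (word l)) : F = G := by
  ext1 w
  suffices hw : w ∈ Submodule.span K (Set.range (word (K := K) (V₀ := V₀) (V₁ := V₁))) from
    LinearMap.eqOn_span' (by rintro _ ⟨l, rfl⟩; exact h l) hw
  induction w using tens_induction with
  | one => exact Submodule.subset_span ⟨[], word_nil⟩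
  | add a b ha hb => exact Submodule.add_mem _ ha hb
  | smul c a ha => exact Submodule.smul_mem _ c ha
  | cons v w hw =>
    induction hw using Submodule.span_induction with
    | mem w hw =>
      obtain ⟨l, rfl⟩ := hw
      have e : TensorAlgebra.ι K v * word l
          = (word (Sum.inl v.1 :: l) + word (Sum.inr v.2 :: l) : Tens K V₀ V₁) := by
        rw [word_cons, word_cons, letter, letter, ← add_mul, ← map_add]
        simp
      rw [e]
      exact Submodule.add_mem _ (Submodule.subset_span ⟨_, rfl⟩) (Submodule.subset_span ⟨_, rfl⟩)
    | zero => simp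
    | add a b _ _ ha hb => rw [mul_add]; exact Submodule.add_mem _ ha hb
    | smul c a _ ha => rw [mul_smul_comm]; exact Submodule.smul_mem _ c ha

theorem red_one : red (1 : Tens K V₀ V₁) = 0 := by simp [red]

theorem red_ι_mul (v : V₀ × V₁) (w : Tens K V₀ V₁) :
    red (TensorAlgebra.ι K v * w) = TensorAlgebra.ι K v * w := by
  simp [red, TensorAlgebra.algebraMapInv]

theorem koszul_ι (k : ℤ) (v : V₀ × V₁) :
    koszul k (TensorAlgebra.ι K v) = TensorAlgebra.ι K (((-1 : K) ^ k) • v.1, v.2) := by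
  simp [koszul]

theorem coprod_one : coprod (1 : Tens K V₀ V₁) = 0 := tRec_one _ _

theorem coprod_ι_mul (v : V₀ × V₁) (w : Tens K V₀ V₁) :
    coprod (TensorAlgebra.ι K v * w) = TensorAlgebra.ι K v ⊗ₜ[K] red w
      + TensorProduct.map (LinearMap.mul K (Tens K V₀ V₁) (TensorAlgebra.ι K v)) LinearMap.id
          (coprod w)
      + TensorProduct.map (koszul 1).toLinearMap
          (LinearMap.mul K (Tens K V₀ V₁) (TensorAlgebra.ι K (v.1, (0 : V₁)))) (coprod w)
      + TensorProduct.map LinearMap.id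
          (LinearMap.mul K (Tens K V₀ V₁) (TensorAlgebra.ι K ((0 : V₀), v.2))) (coprod w) := by
  conv_lhs => rw [coprod, tRec_ι_mul, LinearMap.mk₂_apply]
  rfl

theorem deconc_one : deconc (1 : Tens K V₀ V₁) = 1 ⊗ₜ[K] 1 := tRec_one _ _

theorem deconc_ι_mul (v : V₀ × V₁) (w : Tens K V₀ V₁) :
    deconc (TensorAlgebra.ι K v * w) = 1 ⊗ₜ[K] (TensorAlgebra.ι K v * w)
      + TensorProduct.map (LinearMap.mul K (Tens K V₀ V₁) (TensorAlgebra.ι K v)) LinearMap.id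
          (deconc w) :=
  tRec_ι_mul _ _ _ _

theorem proj₁_one : proj₁ (1 : Tens K V₀ V₁) = 0 := tRec_one _ _

theorem proj₁_ι_mul (v : V₀ × V₁) (w : Tens K V₀ V₁) :
    proj₁ (TensorAlgebra.ι K v * w) = TensorAlgebra.algebraMapInv w • v :=
  tRec_ι_mul _ _ _ _

theorem proj₂_one : proj₂ (1 : Tens K V₀ V₁) = 0 := tRec_one _ _

theorem proj₂_ι_mul (v : V₀ × V₁) (w : Tens K V₀ V₁) :
    proj₂ (TensorAlgebra.ι K v * w) = v ⊗ₜ[K] proj₁ w :=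
  tRec_ι_mul _ _ _ _

theorem proj₃_one : proj₃ (1 : Tens K V₀ V₁) = 0 := tRec_one _ _

theorem proj₃_ι_mul (v : V₀ × V₁) (w : Tens K V₀ V₁) :
    proj₃ (TensorAlgebra.ι K v * w) = v ⊗ₜ[K] proj₂ w :=
  tRec_ι_mul _ _ _ _

/-! ### The grading as a scaling action -/

/-- The operator `sv ↦ 2^|sv| sv` on `sV`. -/
noncomputable def scaleLetter : V₀ × V₁ →ₗ[K] V₀ × V₁ :=
  LinearMap.prodMap ((2 : K) • LinearMap.id) ((4 : K) • LinearMap.id)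

/-- The operator `w ↦ 2^|w| w` on `T(sV)`. -/
noncomputable def scale : Tens K V₀ V₁ →ₐ[K] Tens K V₀ V₁ :=
  TensorAlgebra.lift K (TensorAlgebra.ι K ∘ₗ scaleLetter)

/-- The operator `v ↦ 2^|v| v` on `V₀ ⊕ V₁`. -/
noncomputable def scaleVec : V₀ × V₁ →ₗ[K] V₀ × V₁ :=
  LinearMap.prodMap LinearMap.id ((2 : K) • LinearMap.id)

theorem scale_ι (v : V₀ × V₁) :
    scale (TensorAlgebra.ι K v) = TensorAlgebra.ι K (scaleLetter (K := K) v) := by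
  simp [scale]

theorem scale_word [CharZero K] (l : List (V₀ ⊕ V₁)) :
    scale (word l : Tens K V₀ V₁) = (2 : K) ^ wordDeg l • word l := by
  induction l with
  | nil => simp [word, wordDeg]
  | cons a l ih =>
    have h : wordDeg (a :: l) = letterDeg a + wordDeg l := by simp [wordDeg]
    have hl : scale (letter a : Tens K V₀ V₁) = (2 : K) ^ letterDeg a • letter a := by
      cases a <;> rw [letter, scale_ι, ← map_smul] <;> congr 1 <;>
        simp only [scaleLetter, letterDeg, LinearMap.prodMap_apply, LinearMap.smul_apply,
          LinearMap.id_apply, smul_zero, Prod.smul_mk] <;> norm_num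
    rw [word_cons, map_mul, ih, hl, h, zpow_add₀ two_ne_zero, smul_mul_smul_comm]

theorem mem_gr_iff [CharZero K] (n : ℤ) (v : V₀ × V₁) :
    v ∈ gr K V₀ V₁ n ↔ scaleVec (K := K) v = (2 : K) ^ n • v := by
  -- In characteristic 0 the powers of 2 are already distinct in `ℚ ⊆ K`, so the eigenvalues `2^0`
  -- and `2^1` of `scaleVec` single out the degrees 0 and 1.
  have key (m : ℤ) : (2 : K) ^ m = 1 ↔ m = 0 := by
    have h : (2 : K) ^ m = (((2 : ℚ) ^ m : ℚ) : K) := by rw [Rat.cast_zpow, Rat.cast_ofNat]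
    rw [h, ← Rat.cast_one, Rat.cast_inj]
    exact zpow_eq_one_iff_right₀ (by norm_num) (by norm_num)
  have key₁ : (2 : K) ^ n = 2 ↔ n = 1 := by
    rw [← sub_eq_zero (a := n), ← key (n - 1), zpow_sub₀ two_ne_zero, zpow_one,
      div_eq_one_iff_eq two_ne_zero]
  change ((n ≠ 0 → v.1 = 0) ∧ (n ≠ 1 → v.2 = 0)) ↔ _
  rw [Prod.ext_iff]
  refine and_congr ?_ ?_
  · simp only [scaleVec, LinearMap.prodMap_apply, LinearMap.id_apply, Prod.smul_fst]
    nth_rewrite 2 [← one_smul K v.1]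
    rw [← sub_eq_zero (b := (2 : K) ^ n • v.1), ← sub_smul, smul_eq_zero, sub_eq_zero,
      eq_comm (a := (1 : K)), key]
    tauto
  · simp only [scaleVec, LinearMap.prodMap_apply, LinearMap.id_apply, Prod.smul_snd,
      LinearMap.smul_apply]
    rw [← sub_eq_zero (a := (2 : K) • v.2), ← sub_smul, smul_eq_zero, sub_eq_zero,
      eq_comm (a := (2 : K)), key₁]
    tauto

theorem red_scale (w : Tens K V₀ V₁) : red (scale w) = scale (red w) := by
  suffices h : red ∘ₗ scale.toLinearMap = scale.toLinearMap ∘ₗ red (K := K) (V₀ := V₀) (V₁ := V₁)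
    from LinearMap.congr_fun h w
  apply tens_hom_ext
  · simp [red_one]
  · intro v w _
    simp [red_ι_mul, scale_ι]

theorem koszul_scale (k : ℤ) (w : Tens K V₀ V₁) : koszul k (scale w) = scale (koszul k w) := by
  suffices h : (koszul k).comp scale = scale.comp (koszul (K := K) (V₀ := V₀) (V₁ := V₁) k)
    from AlgHom.congr_fun h w
  ext x <;> simp [scale_ι, koszul_ι, scaleLetter, smul_smul]

/-- Each of the four terms of the recursion is equivariant; in the two terms that move the letter to
the right, the even and the odd part of the letter scale separately. -/
theorem coprod_scale (w : Tens K V₀ V₁) : coprod (scale w)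
    = TensorProduct.map scale.toLinearMap scale.toLinearMap (coprod w) := by
  suffices h : coprod ∘ₗ scale.toLinearMap
      = TensorProduct.map scale.toLinearMap scale.toLinearMap ∘ₗ
        coprod (K := K) (V₀ := V₀) (V₁ := V₁)
    from LinearMap.congr_fun h w
  apply tens_hom_ext
  · simp [coprod_one]
  · intro v w h
    simp only [LinearMap.comp_apply, AlgHom.toLinearMap_apply] at h ⊢
    rw [map_mul, scale_ι, coprod_ι_mul, coprod_ι_mul, h, red_scale]
    clear h
    generalize coprod w = z
    simp only [map_add, TensorProduct.map_tmul, AlgHom.toLinearMap_apply, scale_ι]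
    congr 1
    · congr 1
      · congr 1
        induction z using TensorProduct.induction_on with
        | zero => simp only [map_zero]
        | tmul a b => simp [scale_ι]
        | add x y hx hy => simp only [map_add, hx, hy]
      · induction z using TensorProduct.induction_on with
        | zero => simp only [map_zero]
        | tmul a b => simp [scale_ι, koszul_scale, scaleLetter]
        | add x y hx hy => simp only [map_add, hx, hy]
    · induction z using TensorProduct.induction_on with
      | zero => simp only [map_zero]
      | tmul a b => simp [scale_ι, scaleLetter]
      | add x y hx hy => simp only [map_add, hx, hy]

theorem deconc_scale (w : Tens K V₀ V₁) : deconc (scale w)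
    = TensorProduct.map scale.toLinearMap scale.toLinearMap (deconc w) := by
  suffices h : deconc ∘ₗ scale.toLinearMap
      = TensorProduct.map scale.toLinearMap scale.toLinearMap ∘ₗ
        deconc (K := K) (V₀ := V₀) (V₁ := V₁)
    from LinearMap.congr_fun h w
  apply tens_hom_ext
  · simp [deconc_one]
  · intro v w h
    simp only [LinearMap.comp_apply, AlgHom.toLinearMap_apply] at h ⊢
    rw [map_mul, scale_ι, deconc_ι_mul, deconc_ι_mul, h]
    clear h
    generalize deconc w = z
    simp only [map_add, TensorProduct.map_tmul, AlgHom.toLinearMap_apply, scale_ι, map_one, map_mul]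
    congr 1
    induction z using TensorProduct.induction_on with
    | zero => simp only [map_zero]
    | tmul a b => simp [scale_ι]
    | add x y hx hy => simp only [map_add, hx, hy]

theorem algebraMapInv_scale (w : Tens K V₀ V₁) :
    TensorAlgebra.algebraMapInv (scale w) = TensorAlgebra.algebraMapInv w := by
  suffices h : TensorAlgebra.algebraMapInv.comp scale
      = TensorAlgebra.algebraMapInv (R := K) (M := V₀ × V₁) from AlgHom.congr_fun h w
  ext x <;> simp [scale_ι, TensorAlgebra.algebraMapInv]

theorem proj₁_scale (w : Tens K V₀ V₁) : proj₁ (scale w) = scaleLetter (K := K) (proj₁ w) := by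
  suffices h : proj₁ ∘ₗ scale.toLinearMap
      = scaleLetter ∘ₗ proj₁ (K := K) (V₀ := V₀) (V₁ := V₁) from LinearMap.congr_fun h w
  apply tens_hom_ext
  · simp [proj₁_one]
  · intro v w _
    simp [scale_ι, proj₁_ι_mul, algebraMapInv_scale]

theorem proj₂_scale (w : Tens K V₀ V₁) :
    proj₂ (scale w) = TensorProduct.map scaleLetter scaleLetter (proj₂ w) := by
  suffices h : proj₂ ∘ₗ scale.toLinearMap = TensorProduct.map scaleLetter scaleLetter ∘ₗ
      proj₂ (K := K) (V₀ := V₀) (V₁ := V₁) from LinearMap.congr_fun h w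
  apply tens_hom_ext
  · simp [proj₂_one]
  · intro v w _
    simp [scale_ι, proj₂_ι_mul, proj₁_scale]

theorem proj₃_scale (w : Tens K V₀ V₁) : proj₃ (scale w)
    = TensorProduct.map scaleLetter (TensorProduct.map scaleLetter scaleLetter) (proj₃ w) := by
  suffices h : proj₃ ∘ₗ scale.toLinearMap
      = TensorProduct.map scaleLetter (TensorProduct.map scaleLetter scaleLetter) ∘ₗ
        proj₃ (K := K) (V₀ := V₀) (V₁ := V₁) from LinearMap.congr_fun h w
  apply tens_hom_ext
  · simp [proj₃_one]
  · intro v w _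
    simp [scale_ι, proj₃_ι_mul, proj₂_scale]

/-! ### The codifferential has degree -1 -/

namespace TwoTermLeibniz

variable (V : TwoTermLeibniz K V₀ V₁)

theorem t₂_tmul (u v : V₀ × V₁) :
    V.t₂ (u ⊗ₜ v) = (V.l₂ u.1 v.1, V.l₂r u.1 v.2 + V.l₂l u.2 v.1) := by
  simp [t₂]

theorem t₃_tmul (u v w : V₀ × V₁) : V.t₃ (u ⊗ₜ (v ⊗ₜ w)) = (0, V.l₃ u.1 v.1 w.1) := by
  simp [t₃]

theorem corestr_scale (w : Tens K V₀ V₁) :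
    V.corestr (scale w) = (2 : K) • scaleLetter (K := K) (V.corestr w) := by
  simp only [corestr, LinearMap.add_apply, LinearMap.comp_apply, proj₁_scale, proj₂_scale,
    proj₃_scale, map_add, smul_add]
  congr 1
  · congr 1
    · simp only [t₁, scaleLetter, LinearMap.comp_apply, LinearMap.prodMap_apply,
        LinearMap.snd_apply, LinearMap.inl_apply, LinearMap.smul_apply, LinearMap.id_apply,
        map_smul, map_zero, Prod.smul_mk, smul_zero, smul_smul]
      norm_num
    · generalize proj₂ w = z
      induction z using TensorProduct.induction_on with
      | zero => simp only [map_zero, smul_zero]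
      | tmul a b =>
        simp only [TensorProduct.map_tmul, t₂_tmul, scaleLetter, parity, LinearMap.prodMap_apply,
          LinearMap.smul_apply, LinearMap.id_apply, map_smul, Prod.smul_mk, smul_smul,
          LinearMap.neg_apply, map_neg, smul_add, smul_neg]
        norm_num
      | add x y hx hy => simp only [map_add, hx, hy, smul_add]
  · generalize proj₃ w = z
    induction z using TensorProduct.induction_on with
    | zero => simp only [map_zero, smul_zero]
    | add x y hx hy => simp only [map_add, hx, hy, smul_add]
    | tmul a z =>
      induction z using TensorProduct.induction_on with
      | zero => simp only [TensorProduct.tmul_zero, map_zero, smul_zero]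
      | add x y hx hy => simp only [TensorProduct.tmul_add, map_add, hx, hy, smul_add]
      | tmul b c =>
        simp only [TensorProduct.map_tmul, t₃_tmul, scaleLetter, LinearMap.prodMap_apply,
          LinearMap.smul_apply, LinearMap.id_apply, map_smul, Prod.smul_mk, smul_smul, smul_zero]
        norm_num

theorem codiff_scale (w : Tens K V₀ V₁) :
    V.codiff (scale w) = (2 : K) • scale (V.codiff w) := by
  have hc (w : Tens K V₀ V₁) : coprodPlus (scale w)
      = TensorProduct.map scale.toLinearMap scale.toLinearMap (coprodPlus w) := by
    simp [coprodPlus, coprod_scale, red_scale]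
  -- The corestriction is the only ingredient of the codifferential that is not equivariant; the
  -- factor 2 of degree -1 enters through this inner map alone.
  have hin (w : Tens K V₀ V₁) :
      (LinearMap.mul' K _ ∘ₗ TensorProduct.map (koszul (-1)).toLinearMap
          (TensorAlgebra.ι K ∘ₗ V.corestr) ∘ₗ coprodPlus) (scale w)
        = (2 : K) • scale ((LinearMap.mul' K _ ∘ₗ TensorProduct.map (koszul (-1)).toLinearMap
          (TensorAlgebra.ι K ∘ₗ V.corestr) ∘ₗ coprodPlus) w) := by
    simp only [LinearMap.comp_apply, hc]
    generalize coprodPlus w = z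
    induction z using TensorProduct.induction_on with
    | zero => simp only [map_zero, smul_zero]
    | tmul a b =>
      simp only [TensorProduct.map_tmul, AlgHom.toLinearMap_apply, LinearMap.comp_apply,
        LinearMap.mul'_apply, corestr_scale, koszul_scale, map_smul, mul_smul_comm, map_mul,
        scale_ι]
    | add x y hx hy => simp only [map_add, hx, hy, smul_add]
  rw [codiff]
  generalize LinearMap.mul' K _ ∘ₗ TensorProduct.map (koszul (-1)).toLinearMap
          (TensorAlgebra.ι K ∘ₗ V.corestr) ∘ₗ coprodPlus = G at hin
  simp only [LinearMap.comp_apply, deconc_scale]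
  generalize deconc w = z
  induction z using TensorProduct.induction_on with
  | zero => simp only [map_zero, smul_zero]
  | tmul a b =>
    simp only [TensorProduct.map_tmul, AlgHom.toLinearMap_apply, LinearMap.id_apply,
      LinearMap.mul'_apply, hin, smul_mul_assoc, map_mul]
  | add x y hx hy => simp only [map_add, hx, hy, smul_add]

end TwoTermLeibniz

end Zinbiel

/-! ### The brackets are homogeneous -/

section Degrees

variable {K V₀ V₁ W₀ W₁ : Type*} [Field K]
  [AddCommGroup V₀] [Module K V₀] [AddCommGroup V₁] [Module K V₁]
  [AddCommGroup W₀] [Module K W₀] [AddCommGroup W₁] [Module K W₁]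

theorem conv₂_apply (k₂ : ℤ) (f₁ f₂ : THom K V₀ V₁ W₀ W₁) (w : Tens K V₀ V₁) :
    conv₂ k₂ f₁ f₂ w
      = TensorProduct.map (f₁ ∘ₗ (koszul k₂).toLinearMap) f₂ (coprod w) := rfl

theorem conv₃_apply (k₂ k₃ : ℤ) (f₁ f₂ f₃ : THom K V₀ V₁ W₀ W₁) (w : Tens K V₀ V₁) :
    conv₃ k₂ k₃ f₁ f₂ f₃ w = TensorProduct.assoc K _ _ _
      (TensorProduct.map (conv₂ k₂ f₁ f₂ ∘ₗ (koszul k₃).toLinearMap) f₃ (coprod w)) := rfl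

theorem bracket₁_apply (V : TwoTermLeibniz K V₀ V₁) (W : TwoTermLeibniz K W₀ W₁) (k : ℤ)
    (f : THom K V₀ V₁ W₀ W₁) (w : Tens K V₀ V₁) :
    bracket₁ V W k f w = W.t₁ (f w) + (-1 : K) ^ k • f (V.codiff w) := rfl

theorem bracket₂_apply (W : TwoTermLeibniz K W₀ W₁) (k₁ k₂ : ℤ) (f₁ f₂ : THom K V₀ V₁ W₀ W₁)
    (w : Tens K V₀ V₁) : bracket₂ W k₁ k₂ f₁ f₂ w
      = W.t₂ (conv₂ k₂ f₁ f₂ w) - (-1 : K) ^ (k₁ * k₂) • W.t₂ (conv₂ k₁ f₂ f₁ w) := by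
  simp [bracket₂, antisymm₂]

theorem bracket₃_apply (W : TwoTermLeibniz K W₀ W₁) (k₁ k₂ k₃ : ℤ)
    (f₁ f₂ f₃ : THom K V₀ V₁ W₀ W₁) (w : Tens K V₀ V₁) : bracket₃ W k₁ k₂ k₃ f₁ f₂ f₃ w
      = W.t₃ (conv₃ k₂ k₃ f₁ f₂ f₃ w)
          - ((-1 : K) ^ (k₁ * k₂)) • W.t₃ (conv₃ k₁ k₃ f₂ f₁ f₃ w)
          - ((-1 : K) ^ (k₂ * k₃)) • W.t₃ (conv₃ k₃ k₂ f₁ f₃ f₂ w)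
          + ((-1 : K) ^ (k₁ * k₂ + k₁ * k₃)) • W.t₃ (conv₃ k₃ k₁ f₂ f₃ f₁ w)
          + ((-1 : K) ^ (k₁ * k₃ + k₂ * k₃)) • W.t₃ (conv₃ k₁ k₂ f₃ f₁ f₂ w)
          - ((-1 : K) ^ (k₁ * k₂ + k₁ * k₃ + k₂ * k₃)) • W.t₃ (conv₃ k₂ k₁ f₃ f₂ f₁ w) := by
  simp [bracket₃, antisymm₃]

namespace TwoTermLeibniz

variable (V : TwoTermLeibniz K V₀ V₁)

theorem t₁_scaleVec [CharZero K] (u : V₀ × V₁) :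
    scaleVec (K := K) (V.t₁ u) = (2 : K)⁻¹ • V.t₁ (scaleVec (K := K) u) := by
  simp [t₁, scaleVec]

theorem t₂_scaleVec (z : (V₀ × V₁) ⊗[K] (V₀ × V₁)) :
    scaleVec (K := K) (V.t₂ z) = V.t₂ (TensorProduct.map scaleVec scaleVec z) := by
  induction z using TensorProduct.induction_on with
  | zero => simp only [map_zero]
  | tmul a b => simp [t₂_tmul, scaleVec]
  | add x y hx hy => simp only [map_add, hx, hy]

theorem t₃_scaleVec (z : (V₀ × V₁) ⊗[K] ((V₀ × V₁) ⊗[K] (V₀ × V₁))) :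
    scaleVec (K := K) (V.t₃ z)
      = (2 : K) • V.t₃ (TensorProduct.map scaleVec (TensorProduct.map scaleVec scaleVec) z) := by
  induction z using TensorProduct.induction_on with
  | zero => simp only [map_zero, smul_zero]
  | add x y hx hy => simp only [map_add, hx, hy, smul_add]
  | tmul a z =>
    induction z using TensorProduct.induction_on with
    | zero => simp only [TensorProduct.tmul_zero, map_zero, smul_zero]
    | add x y hx hy => simp only [TensorProduct.tmul_add, map_add, hx, hy, smul_add]
    | tmul b c => simp [t₃_tmul, scaleVec]

end TwoTermLeibniz

variable [CharZero K]

/-- Degree becomes an eigenvalue condition, so the brackets can be shown homogeneous from the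
equivariance of their structure maps, without expanding shuffles on words. -/
theorem mem_convDeg_iff (k : ℤ) (f : THom K V₀ V₁ W₀ W₁) :
    f ∈ convDeg K V₀ V₁ W₀ W₁ k ↔
      f 1 = 0 ∧ ∀ w, scaleVec (K := K) (f w) = (2 : K) ^ k • f (scale w) := by
  change (f 1 = 0 ∧ ∀ l : List (V₀ ⊕ V₁), f (word l) ∈ gr K W₀ W₁ (wordDeg l + k)) ↔ _
  refine and_congr_right fun _ => ⟨fun h w => ?_, fun h l => ?_⟩
  · suffices e : scaleVec ∘ₗ f = (2 : K) ^ k • f ∘ₗ scale.toLinearMap from LinearMap.congr_fun e w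
    refine tens_hom_ext_word fun l => ?_
    rw [LinearMap.comp_apply, (mem_gr_iff _ _).1 (h l), LinearMap.smul_apply, LinearMap.comp_apply,
      AlgHom.toLinearMap_apply, scale_word, map_smul, smul_smul, add_comm, zpow_add₀ two_ne_zero]
  · rw [mem_gr_iff, h, scale_word, map_smul, smul_smul, add_comm, zpow_add₀ two_ne_zero]

theorem bracket₁_mem (V : TwoTermLeibniz K V₀ V₁) (W : TwoTermLeibniz K W₀ W₁) {k : ℤ}
    {f : THom K V₀ V₁ W₀ W₁} (hf : f ∈ convDeg K V₀ V₁ W₀ W₁ k) :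
    bracket₁ V W k f ∈ convDeg K V₀ V₁ W₀ W₁ (k - 1) := by
  rw [mem_convDeg_iff] at hf ⊢
  obtain ⟨h₁, h₂⟩ := hf
  constructor
  · simp [bracket₁_apply, h₁, TwoTermLeibniz.codiff, deconc_one, coprodPlus, coprod_one, red_one]
  · intro w
    have h := h₂ (V.codiff w)
    have e : f (scale (V.codiff w)) = (2 : K)⁻¹ • f (V.codiff (scale w)) := by
      rw [V.codiff_scale, map_smul, smul_smul, inv_mul_cancel₀ two_ne_zero, one_smul]
    rw [bracket₁_apply, bracket₁_apply, map_add, W.t₁_scaleVec, h₂, map_smul, map_smul, h, e,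
      zpow_sub₀ two_ne_zero, zpow_one, div_eq_mul_inv]
    module

theorem conv₂_scale {k₁ k₂ : ℤ} (j : ℤ) {f₁ f₂ : THom K V₀ V₁ W₀ W₁}
    (h₁ : f₁ ∈ convDeg K V₀ V₁ W₀ W₁ k₁) (h₂ : f₂ ∈ convDeg K V₀ V₁ W₀ W₁ k₂)
    (w : Tens K V₀ V₁) :
    TensorProduct.map (scaleVec (K := K)) (scaleVec (K := K)) (conv₂ j f₁ f₂ w)
      = (2 : K) ^ (k₁ + k₂) • conv₂ j f₁ f₂ (scale w) := by
  rw [mem_convDeg_iff] at h₁ h₂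
  rw [conv₂_apply, conv₂_apply, coprod_scale]
  generalize coprod w = z
  induction z using TensorProduct.induction_on with
  | zero => simp only [map_zero, smul_zero]
  | add x y hx hy => simp only [map_add, hx, hy, smul_add]
  | tmul a b =>
    simp only [TensorProduct.map_tmul, LinearMap.comp_apply, AlgHom.toLinearMap_apply, h₁.2, h₂.2,
      koszul_scale, TensorProduct.smul_tmul_smul, zpow_add₀ (two_ne_zero (α := K))]

theorem conv₃_scale {k₁ k₂ k₃ : ℤ} (j j' : ℤ) {f₁ f₂ f₃ : THom K V₀ V₁ W₀ W₁}
    (h₁ : f₁ ∈ convDeg K V₀ V₁ W₀ W₁ k₁) (h₂ : f₂ ∈ convDeg K V₀ V₁ W₀ W₁ k₂)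
    (h₃ : f₃ ∈ convDeg K V₀ V₁ W₀ W₁ k₃) (w : Tens K V₀ V₁) :
    TensorProduct.map (scaleVec (K := K))
        (TensorProduct.map (scaleVec (K := K)) (scaleVec (K := K))) (conv₃ j j' f₁ f₂ f₃ w)
      = (2 : K) ^ (k₁ + k₂ + k₃) • conv₃ j j' f₁ f₂ f₃ (scale w) := by
  have h := conv₂_scale j h₁ h₂
  rw [mem_convDeg_iff] at h₃
  rw [conv₃_apply, conv₃_apply, coprod_scale]
  generalize conv₂ j f₁ f₂ = F at h
  have e (z : ((W₀ × W₁) ⊗[K] (W₀ × W₁)) ⊗[K] (W₀ × W₁)) :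
      TensorProduct.map (scaleVec (K := K))
        (TensorProduct.map (scaleVec (K := K)) (scaleVec (K := K))) (TensorProduct.assoc K _ _ _ z)
      = TensorProduct.assoc K _ _ _
        (TensorProduct.map (TensorProduct.map scaleVec scaleVec) scaleVec z) := by
    exact (LinearMap.congr_fun (TensorProduct.map_map_comp_assoc_eq _ _ _) z)
  rw [e, ← map_smul]
  congr 1
  generalize coprod w = z
  induction z using TensorProduct.induction_on with
  | zero => simp only [map_zero, smul_zero]
  | add x y hx hy => simp only [map_add, hx, hy, smul_add]
  | tmul a b =>
    simp only [TensorProduct.map_tmul, LinearMap.comp_apply, AlgHom.toLinearMap_apply, h, h₃.2,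
      koszul_scale, TensorProduct.smul_tmul_smul, zpow_add₀ (two_ne_zero (α := K))]

theorem bracket₂_mem (W : TwoTermLeibniz K W₀ W₁) {k₁ k₂ : ℤ} {f₁ f₂ : THom K V₀ V₁ W₀ W₁}
    (h₁ : f₁ ∈ convDeg K V₀ V₁ W₀ W₁ k₁) (h₂ : f₂ ∈ convDeg K V₀ V₁ W₀ W₁ k₂) :
    bracket₂ W k₁ k₂ f₁ f₂ ∈ convDeg K V₀ V₁ W₀ W₁ (k₁ + k₂) := by
  rw [mem_convDeg_iff]
  constructor
  · simp [bracket₂_apply, conv₂_apply, coprod_one]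
  · intro w
    simp only [bracket₂_apply, map_sub, map_smul, W.t₂_scaleVec, conv₂_scale _ h₁ h₂,
      conv₂_scale _ h₂ h₁, add_comm k₂ k₁]
    module

/-- The convolution product adds degrees, and the extra 1 is the degree of `m₃`. All six permuted
terms scale by the same power of 2. -/
theorem bracket₃_mem (W : TwoTermLeibniz K W₀ W₁) {k₁ k₂ k₃ : ℤ}
    {f₁ f₂ f₃ : THom K V₀ V₁ W₀ W₁}
    (h₁ : f₁ ∈ convDeg K V₀ V₁ W₀ W₁ k₁) (h₂ : f₂ ∈ convDeg K V₀ V₁ W₀ W₁ k₂)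
    (h₃ : f₃ ∈ convDeg K V₀ V₁ W₀ W₁ k₃) :
    bracket₃ W k₁ k₂ k₃ f₁ f₂ f₃ ∈ convDeg K V₀ V₁ W₀ W₁ (k₁ + k₂ + k₃ + 1) := by
  rw [mem_convDeg_iff]
  constructor
  · simp [bracket₃_apply, conv₃_apply, coprod_one]
  · intro w
    simp only [bracket₃_apply, map_sub, map_add, map_smul, W.t₃_scaleVec,
      conv₃_scale _ _ h₁ h₂ h₃, conv₃_scale _ _ h₂ h₁ h₃, conv₃_scale _ _ h₁ h₃ h₂,
      conv₃_scale _ _ h₂ h₃ h₁, conv₃_scale _ _ h₃ h₁ h₂, conv₃_scale _ _ h₃ h₂ h₁]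
    rw [show k₂ + k₁ + k₃ = k₁ + k₂ + k₃ by ring, show k₁ + k₃ + k₂ = k₁ + k₂ + k₃ by ring,
      show k₂ + k₃ + k₁ = k₁ + k₂ + k₃ by ring, show k₃ + k₁ + k₂ = k₁ + k₂ + k₃ by ring,
      show k₃ + k₂ + k₁ = k₁ + k₂ + k₃ by ring, zpow_add_one₀ two_ne_zero]
    module

end Degrees

/-! ### Structure maps on short words -/

section ShortWords

variable {K V₀ V₁ W₀ W₁ : Type*} [Field K]
  [AddCommGroup V₀] [Module K V₀] [AddCommGroup V₁] [Module K V₁]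
  [AddCommGroup W₀] [Module K W₀] [AddCommGroup W₁] [Module K W₁]

open TensorAlgebra (ι)

theorem red_ι (v : V₀ × V₁) : red (ι K v) = ι K v := by
  simpa using red_ι_mul (K := K) v 1

theorem coprod_ι (v : V₀ × V₁) : coprod (ι K v) = 0 := by
  simpa [red_one, coprod_one] using coprod_ι_mul (K := K) v 1

theorem coprod_ι_mul_ι (u v : V₀ × V₁) : coprod (ι K u * ι K v) = ι K u ⊗ₜ[K] ι K v := by
  simp [coprod_ι_mul, coprod_ι, red_ι]

theorem coprod_ι_mul_ι_mul_ι (u v w : V₀ × V₁) : coprod (ι K u * (ι K v * ι K w))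
    = ι K u ⊗ₜ[K] (ι K v * ι K w) + (ι K u * ι K v) ⊗ₜ[K] ι K w
      + koszul 1 (ι K v) ⊗ₜ[K] (ι K (u.1, (0 : V₁)) * ι K w)
      + ι K v ⊗ₜ[K] (ι K ((0 : V₀), u.2) * ι K w) := by
  simp [coprod_ι_mul u, coprod_ι_mul_ι, red_ι_mul]

theorem deconc_ι (v : V₀ × V₁) : deconc (ι K v) = 1 ⊗ₜ[K] ι K v + ι K v ⊗ₜ[K] 1 := by
  simpa [deconc_one] using deconc_ι_mul (K := K) v 1

theorem algebraMapInv_ι_mul (v : V₀ × V₁) (w : Tens K V₀ V₁) :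
    TensorAlgebra.algebraMapInv (ι K v * w) = 0 := by
  simp [TensorAlgebra.algebraMapInv]

theorem algebraMapInv_ι (v : V₀ × V₁) :
    TensorAlgebra.algebraMapInv (ι K v) = 0 := by
  simp [TensorAlgebra.algebraMapInv]

theorem proj₁_ι (v : V₀ × V₁) : proj₁ (ι K v) = v := by
  simpa using proj₁_ι_mul (K := K) v 1

theorem proj₂_ι (v : V₀ × V₁) : proj₂ (ι K v) = 0 := by
  simpa [proj₁_one] using proj₂_ι_mul (K := K) v 1

theorem proj₃_ι (v : V₀ × V₁) : proj₃ (ι K v) = 0 := by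
  simpa [proj₂_one] using proj₃_ι_mul (K := K) v 1

namespace TwoTermLeibniz

variable (V : TwoTermLeibniz K V₀ V₁)

theorem corestr_ι (u : V₀ × V₁) : V.corestr (ι K u) = V.t₁ u := by
  simp [corestr, proj₁_ι, proj₂_ι, proj₃_ι]

theorem corestr_ι_mul_ι (u v : V₀ × V₁) :
    V.corestr (ι K u * ι K v) = V.t₂ (parity (K := K) u ⊗ₜ v) := by
  simp [corestr, proj₁_ι_mul, proj₂_ι_mul, proj₃_ι_mul, proj₁_ι, proj₂_ι, algebraMapInv_ι]

theorem corestr_ι_mul_ι_mul_ι (u v w : V₀ × V₁) :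
    V.corestr (ι K u * (ι K v * ι K w)) = V.t₃ (u ⊗ₜ (v ⊗ₜ w)) := by
  simp [corestr, proj₁_ι_mul, proj₂_ι_mul, proj₃_ι_mul, proj₁_ι, algebraMapInv_ι,
    algebraMapInv_ι_mul]

theorem codiff_ι (u : V₀ × V₁) : V.codiff (ι K u) = ι K (V.t₁ u) := by
  simp [codiff, deconc_ι, coprodPlus, coprod_ι, coprod_one, red_one, red_ι, corestr_ι]

theorem codiff_ι_mul_ι (u v : V₀ × V₁) : V.codiff (ι K u * ι K v)
    = ι K (V.t₁ u) * ι K v + koszul (-1) (ι K u) * ι K (V.t₁ v)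
      + ι K (V.t₂ (parity (K := K) u ⊗ₜ v)) := by
  simp [codiff, deconc_ι, deconc_ι_mul, coprodPlus, coprod_ι, coprod_ι_mul_ι, coprod_one, red_one,
    red_ι, red_ι_mul, corestr_ι, corestr_ι_mul_ι, add_assoc]

/-- No term with `l₁` occurs, since it vanishes on `V₀`. The minus sign comes from moving `D` past
`x`. In the third term, moving `D` past `y` and exchanging `x` with `y` give two signs that cancel.
-/
theorem codiff_inl_mul_inl_mul_inl (x y z : V₀) :
    V.codiff (ι K (x, (0 : V₁)) * (ι K (y, (0 : V₁)) * ι K (z, (0 : V₁))))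
      = ι K (V.l₂ x y, (0 : V₁)) * ι K (z, (0 : V₁))
        - ι K (x, (0 : V₁)) * ι K (V.l₂ y z, (0 : V₁))
        + ι K (y, (0 : V₁)) * ι K (V.l₂ x z, (0 : V₁))
        + ι K ((0 : V₀), V.l₃ x y z) := by
  have hz : ι K ((0, 0) : V₀ × V₁) = 0 := (ι K).map_zero
  have hneg (x : V₀) : ι K ((-x, 0) : V₀ × V₁) = - ι K (x, 0) := by rw [← map_neg]; simp
  simp [codiff, deconc_ι, deconc_ι_mul, coprodPlus, coprod_ι, coprod_ι_mul_ι,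
    coprod_ι_mul_ι_mul_ι, coprod_one, red_one, koszul_ι,
    red_ι, red_ι_mul, corestr_ι, corestr_ι_mul_ι, corestr_ι_mul_ι_mul_ι, t₁, t₂_tmul, t₃_tmul,
    parity, hz, hneg]
  abel

end TwoTermLeibniz

/-! ### Elements of low degree of the convolution algebra -/

/-- The element of degree `-1` of `L(V, W)` with the components `a : V₀ → W₀`, `b : V₁ → W₁` and
`c : V₀ × V₀ → W₁`. -/
noncomputable def ofComponents (a : V₀ →ₗ[K] W₀) (b : V₁ →ₗ[K] W₁) (c : V₀ →ₗ[K] V₀ →ₗ[K] W₁) :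
    THom K V₀ V₁ W₀ W₁ :=
  LinearMap.prodMap a b ∘ₗ proj₁ +
    LinearMap.inr K W₀ W₁ ∘ₗ TensorProduct.lift c ∘ₗ
      TensorProduct.map (LinearMap.fst K V₀ V₁) (LinearMap.fst K V₀ V₁) ∘ₗ proj₂

/-- The element of degree `0` of `L(V, W)` with the component `θ : V₀ → W₁`. -/
noncomputable def ofParam (θ : V₀ →ₗ[K] W₁) : THom K V₀ V₁ W₀ W₁ :=
  LinearMap.inr K W₀ W₁ ∘ₗ θ ∘ₗ LinearMap.fst K V₀ V₁ ∘ₗ proj₁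

section Values

variable (a : V₀ →ₗ[K] W₀) (b : V₁ →ₗ[K] W₁) (c : V₀ →ₗ[K] V₀ →ₗ[K] W₁) (θ : V₀ →ₗ[K] W₁)

theorem ofComponents_one : ofComponents a b c 1 = 0 := by
  simp [ofComponents, proj₁_one, proj₂_one]

theorem ofComponents_ι (u : V₀ × V₁) : ofComponents a b c (ι K u) = (a u.1, b u.2) := by
  simp [ofComponents, proj₁_ι, proj₂_ι]

theorem ofComponents_ι_mul_ι (u v : V₀ × V₁) :
    ofComponents a b c (ι K u * ι K v) = (0, c u.1 v.1) := by
  simp [ofComponents, proj₁_ι_mul, proj₂_ι_mul, proj₁_ι, algebraMapInv_ι]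

theorem ofComponents_ι_mul_ι_mul_ι_mul (u v w : V₀ × V₁) (z : Tens K V₀ V₁) :
    ofComponents a b c (ι K u * (ι K v * (ι K w * z))) = 0 := by
  simp [ofComponents, proj₁_ι_mul, proj₂_ι_mul, algebraMapInv_ι_mul]

theorem ofComponents_ι_mul_ι_mul_ι (u v w : V₀ × V₁) :
    ofComponents a b c (ι K u * (ι K v * ι K w)) = 0 := by
  simpa using ofComponents_ι_mul_ι_mul_ι_mul a b c u v w 1

theorem ofParam_one : (ofParam θ : THom K V₀ V₁ W₀ W₁) 1 = 0 := by
  simp [ofParam, proj₁_one]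

theorem ofParam_ι (u : V₀ × V₁) : (ofParam θ : THom K V₀ V₁ W₀ W₁) (ι K u) = (0, θ u.1) := by
  simp [ofParam, proj₁_ι]

theorem ofParam_ι_mul_ι_mul (u v : V₀ × V₁) (z : Tens K V₀ V₁) :
    (ofParam θ : THom K V₀ V₁ W₀ W₁) (ι K u * (ι K v * z)) = 0 := by
  simp [ofParam, proj₁_ι_mul, algebraMapInv_ι_mul]

theorem ofParam_ι_mul_ι (u v : V₀ × V₁) :
    (ofParam θ : THom K V₀ V₁ W₀ W₁) (ι K u * ι K v) = 0 := by
  simpa using ofParam_ι_mul_ι_mul θ u v 1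

end Values

/-! ### Homogeneous maps are determined on words of low degree -/

theorem length_le_wordDeg {X Y : Type*} (l : List (X ⊕ Y)) : (l.length : ℤ) ≤ wordDeg l := by
  induction l with
  | nil => simp [wordDeg]
  | cons a l ih =>
    have h : wordDeg (a :: l) = letterDeg a + wordDeg l := by simp [wordDeg]
    rw [h]
    cases a <;> simp [letterDeg] <;> omega

theorem gr_eq_zero {n : ℤ} (hn : 2 ≤ n) {v : V₀ × V₁} (hv : v ∈ gr K V₀ V₁ n) : v = 0 :=
  Prod.ext (hv.1 (by omega)) (hv.2 (by omega))

/-- The words of degree at most `3`. -/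
theorem wordDeg_cases {X Y : Type*} {p : List (X ⊕ Y) → Prop} (hp : ∀ l, 4 ≤ wordDeg l → p l)
    (nil : p []) (x : ∀ x, p [.inl x]) (h : ∀ h, p [.inr h]) (xy : ∀ x y, p [.inl x, .inl y])
    (xh : ∀ x h, p [.inl x, .inr h]) (hx : ∀ h x, p [.inr h, .inl x])
    (xyz : ∀ x y z, p [.inl x, .inl y, .inl z]) (l : List (X ⊕ Y)) : p l := by
  match l with
  | [] => exact nil
  | [.inl a] => exact x a
  | [.inr a] => exact h a
  | [.inl a, .inl b] => exact xy a b
  | [.inl a, .inr b] => exact xh a b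
  | [.inr a, .inl b] => exact hx a b
  | [.inr a, .inr b] => exact hp _ (by simp [wordDeg, letterDeg])
  | [.inl a, .inl b, .inl c] => exact xyz a b c
  | [.inr a, b, c] => exact hp _ (by cases b <;> cases c <;> simp [wordDeg, letterDeg])
  | [.inl a, .inr b, c] => exact hp _ (by cases c <;> simp [wordDeg, letterDeg])
  | [.inl a, .inl b, .inr c] => exact hp _ (by simp [wordDeg, letterDeg])
  | a :: b :: c :: d :: l =>
    refine hp _ (le_trans ?_ (length_le_wordDeg _))
    simp only [List.length_cons, Nat.cast_add, Nat.cast_one]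
    omega

/-- Only words of degree 2 and 3 can have a nonzero image. Their five shapes match the five
relations of an infinity morphism. -/
theorem convDeg_neg_two_ext {f : THom K V₀ V₁ W₀ W₁} (hf : f ∈ convDeg K V₀ V₁ W₀ W₁ (-2))
    (h : ∀ h, f (ι K (0, h)) = 0) (xy : ∀ x y, f (ι K (x, 0) * ι K (y, 0)) = 0)
    (xh : ∀ x h, f (ι K (x, 0) * ι K (0, h)) = 0)
    (hx : ∀ h x, f (ι K (0, h) * ι K (x, 0)) = 0)
    (xyz : ∀ x y z, f (ι K (x, 0) * (ι K (y, 0) * ι K (z, 0))) = 0) : f = 0 := by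
  refine tens_hom_ext_word fun l => ?_
  rw [LinearMap.zero_apply]
  induction l using wordDeg_cases with
  | hp l hl => exact gr_eq_zero (by omega) (hf.2 l)
  | nil => simpa [word] using hf.1
  | x x =>
    have := hf.2 [.inl x]
    exact Prod.ext (this.1 (by simp [wordDeg, letterDeg])) (this.2 (by simp [wordDeg, letterDeg]))
  | h k => simpa [word, letter] using h k
  | xy x y => simpa [word, letter] using xy x y
  | xh x k => simpa [word, letter] using xh x k
  | hx k x => simpa [word, letter] using hx k x
  | xyz x y z => simpa [word, letter] using xyz x y z

/-- Words of degree 1 land in `W₀` and words of degree 2 in `W₁`; everything else is zero. The three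
shapes that remain are the three components of an infinity morphism. -/
theorem convDeg_neg_one_ext {f g : THom K V₀ V₁ W₀ W₁} (hf : f ∈ convDeg K V₀ V₁ W₀ W₁ (-1))
    (hg : g ∈ convDeg K V₀ V₁ W₀ W₁ (-1)) (x : ∀ x, (f (ι K (x, 0))).1 = (g (ι K (x, 0))).1)
    (h : ∀ h, (f (ι K (0, h))).2 = (g (ι K (0, h))).2)
    (xy : ∀ x y, (f (ι K (x, 0) * ι K (y, 0))).2 = (g (ι K (x, 0) * ι K (y, 0))).2) : f = g := by
  refine tens_hom_ext_word fun l => ?_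
  have hl := hf.2 l
  have hl' := hg.2 l
  induction l using wordDeg_cases with
  | hp l hl₄ => rw [gr_eq_zero (by omega) hl, gr_eq_zero (by omega) hl']
  | nil => simpa [word] using hf.1.trans hg.1.symm
  | x a =>
    refine Prod.ext (by simpa [word, letter] using x a) ?_
    rw [hl.2 (by simp [wordDeg, letterDeg]), hl'.2 (by simp [wordDeg, letterDeg])]
  | h k =>
    refine Prod.ext ?_ (by simpa [word, letter] using h k)
    rw [hl.1 (by simp [wordDeg, letterDeg]), hl'.1 (by simp [wordDeg, letterDeg])]
  | xy a b =>
    refine Prod.ext ?_ (by simpa [word, letter] using xy a b)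
    rw [hl.1 (by simp [wordDeg, letterDeg]), hl'.1 (by simp [wordDeg, letterDeg])]
  | xh a k =>
    rw [gr_eq_zero (by simp [wordDeg, letterDeg]) hl, gr_eq_zero (by simp [wordDeg, letterDeg]) hl']
  | hx k a =>
    rw [gr_eq_zero (by simp [wordDeg, letterDeg]) hl, gr_eq_zero (by simp [wordDeg, letterDeg]) hl']
  | xyz a b c =>
    rw [gr_eq_zero (by simp [wordDeg, letterDeg]) hl, gr_eq_zero (by simp [wordDeg, letterDeg]) hl']

theorem convDeg_zero_ext {f g : THom K V₀ V₁ W₀ W₁} (hf : f ∈ convDeg K V₀ V₁ W₀ W₁ 0)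
    (hg : g ∈ convDeg K V₀ V₁ W₀ W₁ 0) (x : ∀ x, (f (ι K (x, 0))).2 = (g (ι K (x, 0))).2) :
    f = g := by
  refine tens_hom_ext_word fun l => ?_
  have hl := hf.2 l
  have hl' := hg.2 l
  induction l using wordDeg_cases with
  | hp l hl₄ => rw [gr_eq_zero (by omega) hl, gr_eq_zero (by omega) hl']
  | nil => simpa [word] using hf.1.trans hg.1.symm
  | x a =>
    refine Prod.ext ?_ (by simpa [word, letter] using x a)
    rw [hl.1 (by simp [wordDeg, letterDeg]), hl'.1 (by simp [wordDeg, letterDeg])]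
  | h | xy | xh | hx | xyz =>
    rw [gr_eq_zero (by simp [wordDeg, letterDeg]) hl, gr_eq_zero (by simp [wordDeg, letterDeg]) hl']

theorem ofComponents_mem [CharZero K] (a : V₀ →ₗ[K] W₀) (b : V₁ →ₗ[K] W₁)
    (c : V₀ →ₗ[K] V₀ →ₗ[K] W₁) : ofComponents a b c ∈ convDeg K V₀ V₁ W₀ W₁ (-1) := by
  rw [mem_convDeg_iff]
  refine ⟨ofComponents_one a b c, fun w => ?_⟩
  simp only [ofComponents, LinearMap.add_apply, LinearMap.comp_apply, proj₁_scale, proj₂_scale,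
    map_add, smul_add]
  congr 1
  · simp only [scaleVec, scaleLetter, LinearMap.prodMap_apply, LinearMap.smul_apply,
      LinearMap.id_apply, map_smul, Prod.smul_mk, smul_smul]
    norm_num
  · generalize proj₂ w = z
    induction z using TensorProduct.induction_on with
    | zero => simp only [map_zero, smul_zero]
    | tmul u v =>
      simp only [TensorProduct.map_tmul, scaleVec, scaleLetter, LinearMap.prodMap_apply,
        LinearMap.smul_apply, LinearMap.id_apply, map_smul, Prod.smul_mk, smul_smul,
        LinearMap.fst_apply, TensorProduct.lift.tmul, LinearMap.inr_apply, smul_zero]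
      norm_num
    | add x y hx hy => simp only [map_add, hx, hy, smul_add]

theorem ofParam_mem [CharZero K] (θ : V₀ →ₗ[K] W₁) :
    (ofParam θ : THom K V₀ V₁ W₀ W₁) ∈ convDeg K V₀ V₁ W₀ W₁ 0 := by
  rw [mem_convDeg_iff]
  refine ⟨ofParam_one θ, fun w => ?_⟩
  simp [ofParam, proj₁_scale, scaleVec, scaleLetter]

theorem eq_ofComponents [CharZero K] {F : THom K V₀ V₁ W₀ W₁}
    (hF : F ∈ convDeg K V₀ V₁ W₀ W₁ (-1)) : ∃ a b c, F = ofComponents a b c := by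
  refine ⟨LinearMap.fst K W₀ W₁ ∘ₗ F ∘ₗ ι K ∘ₗ LinearMap.inl K V₀ V₁,
    LinearMap.snd K W₀ W₁ ∘ₗ F ∘ₗ ι K ∘ₗ LinearMap.inr K V₀ V₁,
    ((LinearMap.mul K (Tens K V₀ V₁)).compl₁₂ (ι K ∘ₗ LinearMap.inl K V₀ V₁)
      (ι K ∘ₗ LinearMap.inl K V₀ V₁)).compr₂ (LinearMap.snd K W₀ W₁ ∘ₗ F),
    convDeg_neg_one_ext hF (ofComponents_mem _ _ _) ?_ ?_ ?_⟩ <;>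
  intros <;> simp [ofComponents_ι, ofComponents_ι_mul_ι]

theorem eq_ofParam [CharZero K] {B : THom K V₀ V₁ W₀ W₁}
    (hB : B ∈ convDeg K V₀ V₁ W₀ W₁ 0) : ∃ θ, B = ofParam θ :=
  ⟨LinearMap.snd K W₀ W₁ ∘ₗ B ∘ₗ ι K ∘ₗ LinearMap.inl K V₀ V₁,
    convDeg_zero_ext hB (ofParam_mem _) fun x => by simp [ofParam_ι]⟩

end ShortWords

/-! ### The Maurer-Cartan equation in components -/

section Components

variable {K V₀ V₁ W₀ W₁ : Type*} [Field K]
  [AddCommGroup V₀] [Module K V₀] [AddCommGroup V₁] [Module K V₁]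
  [AddCommGroup W₀] [Module K W₀] [AddCommGroup W₁] [Module K W₁]

open TensorAlgebra (ι)

variable (V : TwoTermLeibniz K V₀ V₁) (W : TwoTermLeibniz K W₀ W₁)

/-- The left hand side of the Maurer-Cartan equation for an element `F` of degree `-1` of `L(V, W)`.
This is the part of form degree `0` of the curvature of `F + B dt`. -/
noncomputable def flatCurvature (F : THom K V₀ V₁ W₀ W₁) : THom K V₀ V₁ W₀ W₁ :=
  bracket₁ V W (-1) F - (1 / 2 : K) • bracket₂ W (-1) (-1) F F
    - (1 / 6 : K) • bracket₃ W (-1) (-1) (-1) F F F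

/-- The differential of `L(V, W)` twisted by `F`, applied to an element `B` of degree `0`. The part
of form degree `1` of the curvature of `F + B dt` is the difference of this element and of `F'`. -/
noncomputable def twistedDiff (F B : THom K V₀ V₁ W₀ W₁) : THom K V₀ V₁ W₀ W₁ :=
  bracket₁ V W 0 B
    - (1 / 2 : K) • (bracket₂ W (-1) 0 F B - bracket₂ W 0 (-1) B F)
    - (1 / 6 : K) • (bracket₃ W (-1) (-1) 0 F F B - bracket₃ W (-1) 0 (-1) F B F
      + bracket₃ W 0 (-1) (-1) B F F)

/-- For elements of odd degree the Koszul sign and the signature of a permutation cancel, so the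
`p!` terms of the bracket coincide and absorb the factor `1/p!`. The same holds for the ternary
bracket below. -/
theorem bracket₂_neg_one_self [CharZero K] (F : THom K V₀ V₁ W₀ W₁) (w : Tens K V₀ V₁) :
    (1 / 2 : K) • bracket₂ W (-1) (-1) F F w = W.t₂ (conv₂ (-1) F F w) := by
  rw [bracket₂_apply]
  norm_num
  rw [← two_smul K, smul_smul]
  norm_num

theorem bracket₃_neg_one_self [CharZero K] (F : THom K V₀ V₁ W₀ W₁) (w : Tens K V₀ V₁) :
    (1 / 6 : K) • bracket₃ W (-1) (-1) (-1) F F F w = W.t₃ (conv₃ (-1) (-1) F F F w) := by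
  rw [bracket₃_apply]
  norm_num
  generalize W.t₃ _ = u
  module

theorem flatCurvature_apply [CharZero K] (F : THom K V₀ V₁ W₀ W₁) (w : Tens K V₀ V₁) :
    flatCurvature V W F w = W.t₁ (F w) - F (V.codiff w) - W.t₂ (conv₂ (-1) F F w)
      - W.t₃ (conv₃ (-1) (-1) F F F w) := by
  rw [flatCurvature]
  simp only [LinearMap.sub_apply, LinearMap.smul_apply, bracket₂_neg_one_self,
    bracket₃_neg_one_self, bracket₁_apply]
  norm_num
  abel

theorem flatCurvature_mem [CharZero K] {F : THom K V₀ V₁ W₀ W₁}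
    (hF : F ∈ convDeg K V₀ V₁ W₀ W₁ (-1)) :
    flatCurvature V W F ∈ convDeg K V₀ V₁ W₀ W₁ (-2) := by
  have h₁ := bracket₁_mem V W hF
  have h₂ := bracket₂_mem W hF hF
  have h₃ := bracket₃_mem W hF hF hF
  norm_num only at h₁ h₂ h₃
  exact Submodule.sub_mem _ (Submodule.sub_mem _ h₁ (Submodule.smul_mem _ _ h₂))
    (Submodule.smul_mem _ _ h₃)

theorem twistedDiff_mem [CharZero K] {F B : THom K V₀ V₁ W₀ W₁}
    (hF : F ∈ convDeg K V₀ V₁ W₀ W₁ (-1)) (hB : B ∈ convDeg K V₀ V₁ W₀ W₁ 0) :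
    twistedDiff V W F B ∈ convDeg K V₀ V₁ W₀ W₁ (-1) := by
  have h₁ := bracket₁_mem V W hB
  have h₂ := bracket₂_mem W hF hB
  have h₃ := bracket₂_mem W hB hF
  have h₄ := bracket₃_mem W hF hF hB
  have h₅ := bracket₃_mem W hF hB hF
  have h₆ := bracket₃_mem W hB hF hF
  norm_num only at h₁ h₂ h₃ h₄ h₅ h₆
  exact Submodule.sub_mem _ (Submodule.sub_mem _ h₁
    (Submodule.smul_mem _ _ (Submodule.sub_mem _ h₂ h₃)))
    (Submodule.smul_mem _ _ (Submodule.add_mem _ (Submodule.sub_mem _ h₄ h₅) h₆))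

variable (a : V₀ →ₗ[K] W₀) (b : V₁ →ₗ[K] W₁) (c : V₀ →ₗ[K] V₀ →ₗ[K] W₁) (θ : V₀ →ₗ[K] W₁)

theorem flatCurvature_inr [CharZero K] (h : V₁) :
    flatCurvature V W (ofComponents a b c) (ι K (0, h)) = (W.l₁ (b h) - a (V.l₁ h), 0) := by
  simp [flatCurvature_apply, conv₂_apply, conv₃_apply, coprod_ι, V.codiff_ι, ofComponents_ι,
    TwoTermLeibniz.t₁]

theorem flatCurvature_inl_inl [CharZero K] (x y : V₀) :
    flatCurvature V W (ofComponents a b c) (ι K (x, 0) * ι K (y, 0))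
      = (W.l₂ (a x) (a y) + W.l₁ (c x y) - a (V.l₂ x y), 0) := by
  simp [flatCurvature_apply, conv₂_apply, conv₃_apply, coprod_ι_mul_ι, coprod_ι, V.codiff_ι_mul_ι,
    ofComponents_ι, ofComponents_ι_mul_ι, TwoTermLeibniz.t₁, koszul_ι, TwoTermLeibniz.t₂_tmul,
    parity]
  abel

theorem flatCurvature_inl_inr [CharZero K] (x : V₀) (h : V₁) :
    flatCurvature V W (ofComponents a b c) (ι K (x, 0) * ι K (0, h))
      = (0, W.l₂r (a x) (b h) - (b (V.l₂r x h) - c x (V.l₁ h))) := by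
  simp [flatCurvature_apply, conv₂_apply, conv₃_apply, coprod_ι_mul_ι, coprod_ι, V.codiff_ι_mul_ι,
    ofComponents_ι, ofComponents_ι_mul_ι, TwoTermLeibniz.t₁, koszul_ι, TwoTermLeibniz.t₂_tmul,
    parity]
  abel

theorem flatCurvature_inr_inl [CharZero K] (h : V₁) (x : V₀) :
    flatCurvature V W (ofComponents a b c) (ι K (0, h) * ι K (x, 0))
      = (0, b (V.l₂l h x) - c (V.l₁ h) x - W.l₂l (b h) (a x)) := by
  simp [flatCurvature_apply, conv₂_apply, conv₃_apply, coprod_ι_mul_ι, coprod_ι, V.codiff_ι_mul_ι,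
    ofComponents_ι, ofComponents_ι_mul_ι, TwoTermLeibniz.t₁, koszul_ι, TwoTermLeibniz.t₂_tmul,
    parity]
  abel

theorem flatCurvature_inl_inl_inl [CharZero K] (x y z : V₀) :
    flatCurvature V W (ofComponents a b c) (ι K (x, 0) * (ι K (y, 0) * ι K (z, 0)))
      = (0, W.l₃ (a x) (a y) (a z) - W.l₂l (c x y) (a z) + W.l₂r (a x) (c y z)
        - W.l₂r (a y) (c x z)
        - (b (V.l₃ x y z) + c (V.l₂ x y) z - c x (V.l₂ y z) + c y (V.l₂ x z))) := by
  have hz : ι K ((0, 0) : V₀ × V₁) = 0 := (ι K).map_zero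
  simp [flatCurvature_apply, conv₂_apply, conv₃_apply, coprod_ι_mul_ι_mul_ι, coprod_ι_mul_ι,
    coprod_ι, V.codiff_inl_mul_inl_mul_inl, ofComponents_ι_mul_ι_mul_ι, hz,
    ofComponents_ι, ofComponents_ι_mul_ι, TwoTermLeibniz.t₁, koszul_ι, TwoTermLeibniz.t₂_tmul,
    TwoTermLeibniz.t₃_tmul]
  abel

/-- The curvature has degree -2, so it vanishes as soon as it does on the five shapes of words of
degree 2 and 3, and there its values are the defects of the five relations. -/
theorem flatCurvature_ofComponents_eq_zero_iff [CharZero K] :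
    flatCurvature V W (ofComponents a b c) = 0 ↔
      (∀ h, W.l₁ (b h) = a (V.l₁ h)) ∧
      (∀ x y, W.l₂ (a x) (a y) + W.l₁ (c x y) = a (V.l₂ x y)) ∧
      (∀ x h, W.l₂r (a x) (b h) = b (V.l₂r x h) - c x (V.l₁ h)) ∧
      (∀ h x, W.l₂l (b h) (a x) = b (V.l₂l h x) - c (V.l₁ h) x) ∧
      ∀ x y z, W.l₃ (a x) (a y) (a z) - W.l₂l (c x y) (a z) + W.l₂r (a x) (c y z)
          - W.l₂r (a y) (c x z)
        = b (V.l₃ x y z) + c (V.l₂ x y) z - c x (V.l₂ y z) + c y (V.l₂ x z) := by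
  constructor
  · intro e
    refine ⟨fun h => ?_, fun x y => ?_, fun x h => ?_, fun h x => ?_, fun x y z => ?_⟩
    · have := flatCurvature_inr V W a b c h
      rw [e] at this
      exact sub_eq_zero.1 (congrArg Prod.fst this).symm
    · have := flatCurvature_inl_inl V W a b c x y
      rw [e] at this
      exact sub_eq_zero.1 (congrArg Prod.fst this).symm
    · have := flatCurvature_inl_inr V W a b c x h
      rw [e] at this
      exact sub_eq_zero.1 (congrArg Prod.snd this).symm
    · have := flatCurvature_inr_inl V W a b c h x
      rw [e] at this
      exact (sub_eq_zero.1 (congrArg Prod.snd this).symm).symm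
    · have := flatCurvature_inl_inl_inl V W a b c x y z
      rw [e] at this
      exact sub_eq_zero.1 (congrArg Prod.snd this).symm
  · rintro ⟨h₁, h₂, h₃, h₄, h₅⟩
    have hF := ofComponents_mem a b c
    refine convDeg_neg_two_ext (flatCurvature_mem V W hF) ?_ ?_ ?_ ?_ ?_
    · intro h
      exact (flatCurvature_inr V W a b c h).trans (by simp [h₁])
    · intro x y
      exact (flatCurvature_inl_inl V W a b c x y).trans (by simp [h₂])
    · intro x h
      exact (flatCurvature_inl_inr V W a b c x h).trans (by simp [h₃])
    · intro h x
      exact (flatCurvature_inr_inl V W a b c h x).trans (by simp [h₄])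
    · intro x y z
      exact (flatCurvature_inl_inl_inl V W a b c x y z).trans (by simp [h₅])

/-- The result has degree -1, so words of length at most 2 suffice. `Δ²` vanishes on these, hence
`m₃` does not contribute; the factor `1/2` is compensated by the two equal binary terms. -/
theorem twistedDiff_ofComponents_ofParam [CharZero K] :
    twistedDiff V W (ofComponents a b c) (ofParam θ)
      = ofComponents (W.l₁ ∘ₗ θ) (θ ∘ₗ V.l₁)
        (V.l₂.compr₂ θ - W.l₂r.compl₁₂ a θ - W.l₂l.compl₁₂ θ a) := by
  have hF := ofComponents_mem a b c
  have hB := ofParam_mem (K := K) (V₁ := V₁) (W₀ := W₀) θ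
  refine convDeg_neg_one_ext (twistedDiff_mem V W hF hB) (ofComponents_mem _ _ _) ?_ ?_ ?_
  · intro x
    simp [twistedDiff, bracket₁_apply, bracket₂_apply, bracket₃_apply,
      conv₂_apply, conv₃_apply, coprod_ι,
      V.codiff_ι, ofComponents_ι, ofParam_ι, TwoTermLeibniz.t₁]
  · intro x
    simp [twistedDiff, bracket₁_apply, bracket₂_apply, bracket₃_apply,
      conv₂_apply, conv₃_apply, coprod_ι,
      V.codiff_ι, ofComponents_ι, ofParam_ι, TwoTermLeibniz.t₁]
  · intro x y
    simp [twistedDiff, bracket₁_apply, bracket₂_apply, bracket₃_apply,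
      conv₂_apply, conv₃_apply, coprod_ι_mul_ι,
      coprod_ι, V.codiff_ι_mul_ι, ofComponents_ι, ofComponents_ι_mul_ι, ofParam_ι, koszul_ι,
      ofParam_ι_mul_ι, TwoTermLeibniz.t₁, TwoTermLeibniz.t₂_tmul, parity]
    module

end Components

/-! ### Infinity morphisms as Maurer-Cartan elements -/

section Morphisms

variable {K V₀ V₁ W₀ W₁ : Type*} [Field K]
  [AddCommGroup V₀] [Module K V₀] [AddCommGroup V₁] [Module K V₁]
  [AddCommGroup W₀] [Module K W₀] [AddCommGroup W₁] [Module K W₁]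
  {V : TwoTermLeibniz K V₀ V₁} {W : TwoTermLeibniz K W₀ W₁}

theorem ofComponents_inj {a a' : V₀ →ₗ[K] W₀} {b b' : V₁ →ₗ[K] W₁} {c c' : V₀ →ₗ[K] V₀ →ₗ[K] W₁}
    (h : ofComponents a b c = ofComponents a' b' c') : a = a' ∧ b = b' ∧ c = c' := by
  refine ⟨LinearMap.ext fun x => ?_, LinearMap.ext fun k => ?_, LinearMap.ext₂ fun x y => ?_⟩
  · simpa [ofComponents_ι] using
      congrArg Prod.fst (LinearMap.congr_fun h (TensorAlgebra.ι K (x, 0)))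
  · simpa [ofComponents_ι] using
      congrArg Prod.snd (LinearMap.congr_fun h (TensorAlgebra.ι K (0, k)))
  · have := LinearMap.congr_fun h
      (TensorAlgebra.ι K (x, (0 : V₁)) * TensorAlgebra.ι K (y, (0 : V₁)))
    rw [ofComponents_ι_mul_ι, ofComponents_ι_mul_ι] at this
    exact congrArg Prod.snd this

theorem InfMorphism.toL_eq (f : InfMorphism V W) : f.toL = ofComponents f.f₁₀ f.f₁₁ f.f₂ := rfl

/-- This gives the uniqueness of the source and the target of an infinity homotopy. -/
theorem InfMorphism.toL_injective : Function.Injective (InfMorphism.toL (V := V) (W := W)) := by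
  intro f g h
  obtain ⟨h₁, h₂, h₃⟩ := ofComponents_inj (f.toL_eq.symm.trans (h.trans g.toL_eq))
  cases f
  cases g
  simp_all

theorem InfMorphism.flatCurvature_toL [CharZero K] (f : InfMorphism V W) :
    flatCurvature V W f.toL = 0 :=
  (flatCurvature_ofComponents_eq_zero_iff V W _ _ _).2
    ⟨f.rel_a, f.rel_b, f.rel_c₁, f.rel_c₂, f.rel_d⟩

theorem exists_toL_eq [CharZero K] {F : THom K V₀ V₁ W₀ W₁} (hF : F ∈ convDeg K V₀ V₁ W₀ W₁ (-1))
    (h : flatCurvature V W F = 0) : ∃ f : InfMorphism V W, f.toL = F := by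
  obtain ⟨a, b, c, rfl⟩ := eq_ofComponents hF
  obtain ⟨h₁, h₂, h₃, h₄, h₅⟩ := (flatCurvature_ofComponents_eq_zero_iff V W a b c).1 h
  exact ⟨⟨a, b, c, h₁, h₂, h₃, h₄, h₅⟩, rfl⟩

/-- The target of the 2-term homotopy with source `f` and parameter `θ`. -/
noncomputable def InfMorphism.transport (f : InfMorphism V W) (θ : V₀ →ₗ[K] W₁) :
    InfMorphism V W where
  f₁₀ := f.f₁₀ + W.l₁ ∘ₗ θ
  f₁₁ := f.f₁₁ + θ ∘ₗ V.l₁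
  f₂ := f.f₂ + V.l₂.compr₂ θ - W.l₂r.compl₁₂ f.f₁₀ θ - W.l₂l.compl₁₂ θ (f.f₁₀ + W.l₁ ∘ₗ θ)
  rel_a := by
    intro h
    simp [f.rel_a]
  rel_b := by
    intro x y
    simp [← f.rel_b, W.rel_a₁, W.rel_a₂]
    abel
  rel_c₁ := by
    intro x h
    simp [f.rel_c₁, V.rel_a₁, W.rel_b, ← f.rel_a]
    abel
  rel_c₂ := by
    intro h x
    simp [f.rel_c₂, V.rel_a₂, W.rel_b, ← f.rel_a]
    abel
  rel_d := by
    intro x y z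
    have h := f.rel_d x y z
    -- Every value of `l₃` with an argument `W.l₁ (θ _)` becomes a combination of iterated `l₂`, and
    -- so does `V.l₁` of `V.l₃`. With the boundaries moved by the remaining relations, all terms in
    -- `θ` cancel and the relation for `f` is left.
    simp [W.rel_d₁, W.rel_d₂, W.rel_d₃, V.rel_c, W.rel_b, ← f.rel_b, W.rel_a₁, W.rel_a₂]
    rw [← sub_eq_zero] at h ⊢
    rw [← h]
    abel

end Morphisms

/-! ### Pointwise values of forms with values in `L(V, W)` -/

section Values

variable {K V₀ V₁ W₀ W₁ : Type*} [Field K]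
  [AddCommGroup V₀] [Module K V₀] [AddCommGroup V₁] [Module K V₁]
  [AddCommGroup W₀] [Module K W₀] [AddCommGroup W₁] [Module K W₁]

/-- The value `a(t)` of a form `a + b dt`. -/
noncomputable def formVal (t : K) : Forms K →ₗ[K] K where
  toFun ω := ω.fst.eval t
  map_add' := by intros; simp
  map_smul' := by intros; simp

/-- The value `b(t)` of a form `a + b dt`. -/
noncomputable def formCoeff (t : K) : Forms K →ₗ[K] K where
  toFun ω := ω.snd.eval t
  map_add' := by intros; simp
  map_smul' := by intros; simp

/-- The value `F(t)` of `F + B dt`. -/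
noncomputable def valAt (t : K) : LForms K V₀ V₁ W₀ W₁ →ₗ[K] THom K V₀ V₁ W₀ W₁ :=
  (TensorProduct.rid K _).toLinearMap ∘ₗ TensorProduct.map LinearMap.id (formVal t)

/-- The value `B(t)` of `F + B dt`. -/
noncomputable def coeffAt (t : K) : LForms K V₀ V₁ W₀ W₁ →ₗ[K] THom K V₀ V₁ W₀ W₁ :=
  (TensorProduct.rid K _).toLinearMap ∘ₗ TensorProduct.map LinearMap.id (formCoeff t)

theorem valAt_tmul (t : K) (f : THom K V₀ V₁ W₀ W₁) (ω : Forms K) :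
    valAt t (f ⊗ₜ ω) = ω.fst.eval t • f := by
  simp [valAt, formVal]

theorem coeffAt_tmul (t : K) (f : THom K V₀ V₁ W₀ W₁) (ω : Forms K) :
    coeffAt t (f ⊗ₜ ω) = ω.snd.eval t • f := by
  simp [coeffAt, formCoeff]

theorem evalAt_eq_valAt (i : Fin 2) :
    (evalAt i : LForms K V₀ V₁ W₀ W₁ →ₗ[K] THom K V₀ V₁ W₀ W₁) = valAt (i.val : K) := rfl

theorem formPr_zero (ω : Forms K) : formPr 0 ω = TrivSqZeroExt.inl ω.fst := by simp [formPr]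

theorem formPr_one (ω : Forms K) : formPr 1 ω = TrivSqZeroExt.inr ω.snd := by simp [formPr]

theorem pr_tmul (j : Fin 2) (f : THom K V₀ V₁ W₀ W₁) (ω : Forms K) :
    pr j (f ⊗ₜ[K] ω) = f ⊗ₜ[K] formPr j ω := rfl

/-- The derivative `F'(t)` of `F + B dt`. -/
noncomputable def derivAt (t : K) : LForms K V₀ V₁ W₀ W₁ →ₗ[K] THom K V₀ V₁ W₀ W₁ :=
  coeffAt t ∘ₗ TensorProduct.map LinearMap.id formD

theorem derivAt_tmul (t : K) (f : THom K V₀ V₁ W₀ W₁) (ω : Forms K) :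
    derivAt t (f ⊗ₜ ω) = (Polynomial.derivative ω.fst).eval t • f := by
  simp [derivAt, coeffAt_tmul, formD]

/-! ### The curvature at a parameter value -/

section Curvature

variable (V : TwoTermLeibniz K V₀ V₁) (W : TwoTermLeibniz K W₀ W₁) (t : K)
  (F₁ F₂ F₃ : LForms K V₀ V₁ W₀ W₁)

theorem valAt_extBracket₁ :
    valAt t (extBracket₁ V W (-1) F₁) = bracket₁ V W (-1) (valAt t F₁) := by
  induction F₁ using TensorProduct.induction_on with
  | zero => simp [extBracket₁]
  | add x y hx hy =>
    rw [map_add, map_add, ← hx, ← hy]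
    simp only [extBracket₁, map_add, Fin.sum_univ_two, smul_add]
    abel
  | tmul f ω =>
    simp [extBracket₁, Fin.sum_univ_two, pr_tmul, formPr_zero, formPr_one, valAt_tmul, formD]

theorem coeffAt_extBracket₁ :
    coeffAt t (extBracket₁ V W (-1) F₁) = bracket₁ V W 0 (coeffAt t F₁) - derivAt t F₁ := by
  induction F₁ using TensorProduct.induction_on with
  | zero => simp [extBracket₁]
  | add x y hx hy =>
    have e : extBracket₁ V W (-1) (x + y) = extBracket₁ V W (-1) x + extBracket₁ V W (-1) y := by
      simp only [extBracket₁, map_add, Fin.sum_univ_two, smul_add]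
      abel
    rw [e, map_add, hx, hy]
    simp only [map_add]
    abel
  | tmul f ω =>
    simp [extBracket₁, Fin.sum_univ_two, pr_tmul, formPr_zero, formPr_one, coeffAt_tmul, formD,
      derivAt_tmul]
    module

theorem extBracket₂_add_left (G : LForms K V₀ V₁ W₀ W₁) (n₁ n₂ : ℤ) :
    extBracket₂ W n₁ n₂ (F₁ + G) F₂ = extBracket₂ W n₁ n₂ F₁ F₂ + extBracket₂ W n₁ n₂ G F₂ := by
  simp only [extBracket₂, map_add, LinearMap.add_apply, smul_add, Finset.sum_add_distrib]

theorem extBracket₂_add_right (G : LForms K V₀ V₁ W₀ W₁) (n₁ n₂ : ℤ) :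
    extBracket₂ W n₁ n₂ F₁ (F₂ + G) = extBracket₂ W n₁ n₂ F₁ F₂ + extBracket₂ W n₁ n₂ F₁ G := by
  simp only [extBracket₂, map_add, smul_add, Finset.sum_add_distrib]

theorem valAt_extBracket₂ : valAt t (extBracket₂ W (-1) (-1) F₁ F₂)
    = bracket₂ W (-1) (-1) (valAt t F₁) (valAt t F₂) := by
  induction F₁ using TensorProduct.induction_on with
  | zero => simp [extBracket₂]
  | add x y hx hy =>
    rw [extBracket₂_add_left, map_add, hx, hy, map_add, map_add, LinearMap.add_apply]
  | tmul f ω =>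
    induction F₂ using TensorProduct.induction_on with
    | zero => simp [extBracket₂]
    | add x y hx hy => rw [extBracket₂_add_right, map_add, hx, hy, map_add, map_add]
    | tmul g η =>
      simp [extBracket₂, Fin.sum_univ_two, pr_tmul, formPr_zero, formPr_one, valAt_tmul, smul_smul,
        mul_comm]

/-- As `(dt)² = 0`, exactly one factor carries `dt`, and its `L`-part then has degree 0. The minus
sign arises when `dt` passes the second factor, of degree -1. In the ternary case `dt` passes two,
one or no such factors. -/
theorem coeffAt_extBracket₂ : coeffAt t (extBracket₂ W (-1) (-1) F₁ F₂)
    = bracket₂ W (-1) 0 (valAt t F₁) (coeffAt t F₂)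
      - bracket₂ W 0 (-1) (coeffAt t F₁) (valAt t F₂) := by
  induction F₁ using TensorProduct.induction_on with
  | zero => simp [extBracket₂]
  | add x y hx hy =>
    rw [extBracket₂_add_left, map_add, hx, hy]
    simp only [map_add, LinearMap.add_apply]
    abel
  | tmul f ω =>
    induction F₂ using TensorProduct.induction_on with
    | zero => simp [extBracket₂]
    | add x y hx hy =>
      rw [extBracket₂_add_right, map_add, hx, hy]
      simp only [map_add]
      abel
    | tmul g η =>
      simp [extBracket₂, Fin.sum_univ_two, pr_tmul, formPr_zero, formPr_one, valAt_tmul,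
        coeffAt_tmul, smul_smul, mul_comm]
      abel

theorem extBracket₃_add_left (G : LForms K V₀ V₁ W₀ W₁) (n₁ n₂ n₃ : ℤ) :
    extBracket₃ W n₁ n₂ n₃ (F₁ + G) F₂ F₃
      = extBracket₃ W n₁ n₂ n₃ F₁ F₂ F₃ + extBracket₃ W n₁ n₂ n₃ G F₂ F₃ := by
  simp only [extBracket₃, map_add, LinearMap.add_apply, smul_add, Finset.sum_add_distrib]

theorem extBracket₃_add_middle (G : LForms K V₀ V₁ W₀ W₁) (n₁ n₂ n₃ : ℤ) :
    extBracket₃ W n₁ n₂ n₃ F₁ (F₂ + G) F₃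
      = extBracket₃ W n₁ n₂ n₃ F₁ F₂ F₃ + extBracket₃ W n₁ n₂ n₃ F₁ G F₃ := by
  simp only [extBracket₃, map_add, LinearMap.add_apply, smul_add, Finset.sum_add_distrib]

theorem extBracket₃_add_right (G : LForms K V₀ V₁ W₀ W₁) (n₁ n₂ n₃ : ℤ) :
    extBracket₃ W n₁ n₂ n₃ F₁ F₂ (F₃ + G)
      = extBracket₃ W n₁ n₂ n₃ F₁ F₂ F₃ + extBracket₃ W n₁ n₂ n₃ F₁ F₂ G := by
  simp only [extBracket₃, map_add, smul_add, Finset.sum_add_distrib]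

theorem valAt_extBracket₃ : valAt t (extBracket₃ W (-1) (-1) (-1) F₁ F₂ F₃)
    = bracket₃ W (-1) (-1) (-1) (valAt t F₁) (valAt t F₂) (valAt t F₃) := by
  induction F₁ using TensorProduct.induction_on with
  | zero => simp [extBracket₃]
  | add x y hx hy =>
    rw [extBracket₃_add_left, map_add, hx, hy]
    simp only [map_add, LinearMap.add_apply]
  | tmul f ω =>
    induction F₂ using TensorProduct.induction_on with
    | zero => simp [extBracket₃]
    | add x y hx hy =>
      rw [extBracket₃_add_middle, map_add, hx, hy]
      simp only [map_add, LinearMap.add_apply]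
    | tmul g η =>
      induction F₃ using TensorProduct.induction_on with
      | zero => simp [extBracket₃]
      | add x y hx hy =>
        rw [extBracket₃_add_right, map_add, hx, hy]
        simp only [map_add]
      | tmul h ζ =>
        simp [extBracket₃, Fin.sum_univ_two, pr_tmul, formPr_zero, formPr_one, valAt_tmul,
          smul_smul]
        module

theorem coeffAt_extBracket₃ : coeffAt t (extBracket₃ W (-1) (-1) (-1) F₁ F₂ F₃)
    = bracket₃ W (-1) (-1) 0 (valAt t F₁) (valAt t F₂) (coeffAt t F₃)
      - bracket₃ W (-1) 0 (-1) (valAt t F₁) (coeffAt t F₂) (valAt t F₃)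
      + bracket₃ W 0 (-1) (-1) (coeffAt t F₁) (valAt t F₂) (valAt t F₃) := by
  induction F₁ using TensorProduct.induction_on with
  | zero => simp [extBracket₃]
  | add x y hx hy =>
    rw [extBracket₃_add_left, map_add, hx, hy]
    simp only [map_add, LinearMap.add_apply]
    abel
  | tmul f ω =>
    induction F₂ using TensorProduct.induction_on with
    | zero => simp [extBracket₃]
    | add x y hx hy =>
      rw [extBracket₃_add_middle, map_add, hx, hy]
      simp only [map_add, LinearMap.add_apply]
      abel
    | tmul g η =>
      induction F₃ using TensorProduct.induction_on with
      | zero => simp [extBracket₃]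
      | add x y hx hy =>
        rw [extBracket₃_add_right, map_add, hx, hy]
        simp only [map_add]
        abel
      | tmul h ζ =>
        simp [extBracket₃, Fin.sum_univ_two, pr_tmul, formPr_zero, formPr_one, valAt_tmul,
          coeffAt_tmul, smul_smul]
        module

theorem valAt_curvature (α : LForms K V₀ V₁ W₀ W₁) :
    valAt t (curvature V W α) = flatCurvature V W (valAt t α) := by
  simp only [curvature, map_sub, map_smul, valAt_extBracket₁, valAt_extBracket₂, valAt_extBracket₃,
    flatCurvature]

/-- The `dt` part of the Maurer-Cartan equation is a differential equation in `t`. -/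
theorem coeffAt_curvature (α : LForms K V₀ V₁ W₀ W₁) :
    coeffAt t (curvature V W α) = twistedDiff V W (valAt t α) (coeffAt t α) - derivAt t α := by
  simp only [curvature, map_sub, map_smul, coeffAt_extBracket₁, coeffAt_extBracket₂,
    coeffAt_extBracket₃, twistedDiff]
  abel

end Curvature

theorem totDeg_le {n : ℤ} {S : Submodule K (LForms K V₀ V₁ W₀ W₁)}
    (val : ∀ f ∈ convDeg K V₀ V₁ W₀ W₁ n, ∀ q : K[X], f ⊗ₜ TrivSqZeroExt.inl q ∈ S)
    (coeff : ∀ f ∈ convDeg K V₀ V₁ W₀ W₁ (n + 1), ∀ q : K[X], f ⊗ₜ TrivSqZeroExt.inr q ∈ S) :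
    totDeg K V₀ V₁ W₀ W₁ n ≤ S := by
  refine iSup_le fun j => Submodule.map₂_le.2 ?_
  rintro f hf _ ⟨ω, rfl⟩
  fin_cases j
  · simpa [formPr_zero] using val f (by simpa using hf) ω.fst
  · simpa [formPr_one] using coeff f (by simpa using hf) ω.snd

theorem valAt_mem {α : LForms K V₀ V₁ W₀ W₁} (hα : α ∈ totDeg K V₀ V₁ W₀ W₁ (-1)) (t : K) :
    valAt t α ∈ convDeg K V₀ V₁ W₀ W₁ (-1) := by
  suffices h : totDeg K V₀ V₁ W₀ W₁ (-1) ≤ (convDeg K V₀ V₁ W₀ W₁ (-1)).comap (valAt t) from h hα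
  refine totDeg_le (fun f hf q => ?_) (fun f hf q => ?_)
  · rw [Submodule.mem_comap, valAt_tmul]
    exact Submodule.smul_mem _ _ hf
  · simp [valAt_tmul]

theorem coeffAt_mem {α : LForms K V₀ V₁ W₀ W₁} (hα : α ∈ totDeg K V₀ V₁ W₀ W₁ (-1)) (t : K) :
    coeffAt t α ∈ convDeg K V₀ V₁ W₀ W₁ 0 := by
  suffices h : totDeg K V₀ V₁ W₀ W₁ (-1) ≤ (convDeg K V₀ V₁ W₀ W₁ 0).comap (coeffAt t) from h hα
  refine totDeg_le (fun f hf q => ?_) (fun f hf q => ?_)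
  · simp [coeffAt_tmul]
  · rw [Submodule.mem_comap, coeffAt_tmul]
    exact Submodule.smul_mem _ _ hf

theorem val_tmul_mem_totDeg {f : THom K V₀ V₁ W₀ W₁} (hf : f ∈ convDeg K V₀ V₁ W₀ W₁ (-1))
    (q : K[X]) : f ⊗ₜ[K] TrivSqZeroExt.inl q ∈ totDeg K V₀ V₁ W₀ W₁ (-1) :=
  Submodule.mem_iSup_of_mem 0 (Submodule.apply_mem_map₂ _ (by simpa using hf)
    ⟨TrivSqZeroExt.inl q, by simp [formPr_zero]⟩)

theorem coeff_tmul_mem_totDeg {f : THom K V₀ V₁ W₀ W₁} (hf : f ∈ convDeg K V₀ V₁ W₀ W₁ 0)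
    (q : K[X]) : f ⊗ₜ[K] TrivSqZeroExt.inr q ∈ totDeg K V₀ V₁ W₀ W₁ (-1) :=
  Submodule.mem_iSup_of_mem 1 (Submodule.apply_mem_map₂ _ (by simpa using hf)
    ⟨TrivSqZeroExt.inr q, by simp [formPr_one]⟩)

/-- An element of `L ⊗ Ω₁` is determined by its pointwise values. -/
theorem eq_zero_of_valAt_of_coeffAt [Infinite K] {x : LForms K V₀ V₁ W₀ W₁}
    (h₀ : ∀ t, valAt t x = 0) (h₁ : ∀ t, coeffAt t x = 0) : x = 0 := by
  classical
  -- Coordinates in a basis of `L` turn an element of `L ⊗ Ω₁` into a finitely supported family of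
  -- forms. It remains to see that polynomials vanishing at every point of an infinite field are
  -- zero.
  let B := Module.Basis.ofVectorSpace K (THom K V₀ V₁ W₀ W₁)
  apply (TensorProduct.equivFinsuppOfBasisLeft (N := Forms K) B).injective
  rw [map_zero]
  ext1 n
  rw [Finsupp.zero_apply]
  have hv (t : K) (y : LForms K V₀ V₁ W₀ W₁) :
      (TensorProduct.equivFinsuppOfBasisLeft B y n).fst.eval t = B.coord n (valAt t y) := by
    induction y using TensorProduct.induction_on with
    | zero => simp
    | add y z hy hz => simp only [map_add, Finsupp.add_apply, TrivSqZeroExt.fst_add,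
        Polynomial.eval_add, hy, hz]
    | tmul f ω => simp [valAt_tmul, mul_comm]
  have hc (t : K) (y : LForms K V₀ V₁ W₀ W₁) :
      (TensorProduct.equivFinsuppOfBasisLeft B y n).snd.eval t = B.coord n (coeffAt t y) := by
    induction y using TensorProduct.induction_on with
    | zero => simp
    | add y z hy hz => simp only [map_add, Finsupp.add_apply, TrivSqZeroExt.snd_add,
        Polynomial.eval_add, hy, hz]
    | tmul f ω => simp [coeffAt_tmul, mul_comm]
  refine TrivSqZeroExt.ext (Polynomial.funext fun t => ?_) (Polynomial.funext fun t => ?_)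
  · rw [hv, h₀]
    simp
  · rw [hc, h₁]
    simp

end Values

/-! ### Polynomial curves -/

section PolyCurves

variable {K : Type*} [Field K] {M N P : Type*} [AddCommGroup M] [Module K M] [AddCommGroup N]
  [Module K N] [AddCommGroup P] [Module K P]

variable (K M) in
/-- The pairs `(u, u')` of a polynomial curve in a vector space and its derivative. -/
def polyCurves : Submodule K ((K → M) × (K → M)) :=
  Submodule.span K (Set.range fun p : K[X] × M =>
    ((fun t => p.1.eval t • p.2), (fun t => (Polynomial.derivative p.1).eval t • p.2)))

theorem eval_smul_mem_polyCurves (q : K[X]) (m : M) :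
    ((fun t => q.eval t • m), (fun t => (Polynomial.derivative q).eval t • m)) ∈ polyCurves K M :=
  Submodule.subset_span ⟨(q, m), rfl⟩

theorem const_mem_polyCurves (m : M) : ((fun _ => m), (fun _ => 0)) ∈ polyCurves K M := by
  simpa using eval_smul_mem_polyCurves (1 : K[X]) m

theorem polyCurves_induction {p : ∀ u u' : K → M, (u, u') ∈ polyCurves K M → Prop}
    (mem : ∀ (q : K[X]) (m : M), p _ _ (eval_smul_mem_polyCurves q m))
    (zero : p 0 0 (Submodule.zero_mem _))
    (add : ∀ u u' v v' hu hv, p u u' hu → p v v' hv →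
      p (u + v) (u' + v') (Submodule.add_mem _ hu hv))
    (smul : ∀ (c : K) u u' hu, p u u' hu → p (c • u) (c • u') (Submodule.smul_mem _ c hu))
    (u u' : K → M) (h : (u, u') ∈ polyCurves K M) : p u u' h := by
  have key (x : (K → M) × (K → M)) (hx : x ∈ polyCurves K M) : p x.1 x.2 hx := by
    induction hx using Submodule.span_induction with
    | mem x hx =>
      obtain ⟨⟨q, m⟩, rfl⟩ := hx
      exact mem q m
    | zero => exact zero
    | add x y hx hy ihx ihy => exact add x.1 x.2 y.1 y.2 hx hy ihx ihy
    | smul c x hx ih => exact smul c x.1 x.2 hx ih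
  exact key (u, u') h

theorem polyCurves_map (L : M →ₗ[K] N) {u u' : K → M} (h : (u, u') ∈ polyCurves K M) :
    ((fun t => L (u t)), (fun t => L (u' t))) ∈ polyCurves K N := by
  induction u, u', h using polyCurves_induction with
  | mem q m => simpa using eval_smul_mem_polyCurves q (L m)
  | zero => simpa using const_mem_polyCurves (K := K) (0 : N)
  | add u u' v v' _ _ hu hv => convert Submodule.add_mem _ hu hv using 1; ext t <;> simp
  | smul c u u' _ hu => convert Submodule.smul_mem _ c hu using 1; ext t <;> simp

/-- This Leibniz rule is what integrates the quadratic term of the differential equation. -/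
theorem polyCurves_map₂ (L : M →ₗ[K] N →ₗ[K] P) {u u' : K → M} {v v' : K → N}
    (hu : (u, u') ∈ polyCurves K M) (hv : (v, v') ∈ polyCurves K N) :
    ((fun t => L (u t) (v t)), (fun t => L (u' t) (v t) + L (u t) (v' t))) ∈ polyCurves K P := by
  induction u, u', hu using polyCurves_induction with
  | zero => simpa using const_mem_polyCurves (K := K) (0 : P)
  | add u u' w w' _ _ hu hw =>
    convert Submodule.add_mem _ hu hw using 1
    ext t <;> simp
    abel
  | smul c u u' _ hu =>
    convert Submodule.smul_mem _ c hu using 1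
    ext t <;> simp
  | mem q m =>
    induction v, v', hv using polyCurves_induction with
    | zero => simpa using const_mem_polyCurves (K := K) (0 : P)
    | add u u' w w' _ _ hu hw =>
      convert Submodule.add_mem _ hu hw using 1
      ext t <;> simp
      abel
    | smul c u u' _ hu =>
      convert Submodule.smul_mem _ c hu using 1
      ext t <;> simp [smul_comm c]
    | mem r n =>
      convert eval_smul_mem_polyCurves (q * r) (L m n) using 1
      ext t <;> simp [smul_smul, add_smul, mul_comm]

/-- Linear functionals separate points and turn the curve into a scalar polynomial with zero
derivative, which is constant in characteristic 0. No topology and no finite dimension is needed. -/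
theorem eq_of_polyCurves_zero [CharZero K] {u : K → M} (h : (u, fun _ => 0) ∈ polyCurves K M)
    (s t : K) : u s = u t := by
  rw [← sub_eq_zero, ← Module.forall_dual_apply_eq_zero_iff K]
  intro φ
  have hq (v v' : K → K) (hv : (v, v') ∈ polyCurves K K) : ∃ q : K[X],
      (∀ t, v t = q.eval t) ∧ ∀ t, v' t = (Polynomial.derivative q).eval t := by
    induction v, v', hv using polyCurves_induction with
    | mem q m => exact ⟨Polynomial.C m * q, by simp [mul_comm], by simp [mul_comm]⟩
    | zero => exact ⟨0, by simp, by simp⟩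
    | add v v' w w' _ _ hv hw =>
      obtain ⟨q, h₁, h₂⟩ := hv
      obtain ⟨r, h₃, h₄⟩ := hw
      exact ⟨q + r, by simp [h₁, h₃], by simp [h₂, h₄]⟩
    | smul c v v' _ hv =>
      obtain ⟨q, h₁, h₂⟩ := hv
      exact ⟨c • q, by simp [h₁], by simp [h₂]⟩
  obtain ⟨q, h₁, h₂⟩ := hq _ _ (polyCurves_map φ h)
  have h₃ : Polynomial.derivative q = 0 := Polynomial.funext fun t => by rw [← h₂]; simp
  rw [map_sub, h₁, h₁, Polynomial.eq_C_of_derivative_eq_zero h₃]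
  simp

end PolyCurves

/-! ### From infinity homotopies to 2-term homotopies -/

section Integration

variable {K V₀ V₁ W₀ W₁ : Type*} [Field K]
  [AddCommGroup V₀] [Module K V₀] [AddCommGroup V₁] [Module K V₁]
  [AddCommGroup W₀] [Module K W₀] [AddCommGroup W₁] [Module K W₁]

theorem valAt_mem_polyCurves (α : LForms K V₀ V₁ W₀ W₁) :
    ((fun t => valAt t α), (fun t => derivAt t α)) ∈ polyCurves K (THom K V₀ V₁ W₀ W₁) := by
  induction α using TensorProduct.induction_on with
  | zero => simpa using const_mem_polyCurves (K := K) (0 : THom K V₀ V₁ W₀ W₁)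
  | add x y hx hy => simp only [map_add]; exact Submodule.add_mem _ hx hy
  | tmul f ω => simpa only [valAt_tmul, derivAt_tmul] using eval_smul_mem_polyCurves ω.fst f

theorem derivative_primitive [CharZero K] (q : K[X]) :
    Polynomial.derivative (primitive q) = q := by
  induction q using Polynomial.induction_on' with
  | add p q hp hq => rw [map_add, map_add, hp, hq]
  | monomial n a =>
    have h : (n + 1 : K) ≠ 0 := by exact_mod_cast n.succ_ne_zero
    simp [primitive, Polynomial.lsum_apply, Polynomial.sum_monomial_index,
      Polynomial.smul_monomial, mul_right_comm _ a, h]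

theorem primitive_one : primitive (1 : K[X]) = Polynomial.X := by
  rw [← Polynomial.monomial_zero_one, primitive, Polynomial.lsum_apply,
    Polynomial.sum_monomial_index _ _ (by simp)]
  simp [Polynomial.monomial_one_one_eq_X]

/-- Only form degree 1 survives integration, and there the factor in `L` has degree 0, so the Koszul
sign is trivial. -/
theorem homotopyOp_tmul (i : Fin 2) (f : THom K V₀ V₁ W₀ W₁) (ω : Forms K) :
    homotopyOp i (-1) (f ⊗ₜ[K] ω) = f ⊗ₜ[K] formH i ω := by
  have h : formH i (formPr 0 ω) = 0 := by simp [formH, formPr_zero]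
  have h' : formH i (formPr 1 ω) = formH i ω := by simp [formH, formPr_one]
  simp [homotopyOp, pr_tmul, h, h']

theorem derivAt_homotopyOp [CharZero K] (i : Fin 2) (α : LForms K V₀ V₁ W₀ W₁) (t : K) :
    derivAt t (homotopyOp i (-1) α) = coeffAt t α := by
  induction α using TensorProduct.induction_on with
  | zero => simp
  | add x y hx hy => rw [map_add, map_add, map_add, hx, hy]
  | tmul f ω =>
    simp [homotopyOp_tmul, derivAt_tmul, coeffAt_tmul, formH, derivative_primitive]

theorem homotopyParam_apply (i : Fin 2) (α : LForms K V₀ V₁ W₀ W₁) (x : V₀) :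
    homotopyParam i α x = (valAt 1 (homotopyOp i (-1) α) (TensorAlgebra.ι K (x, 0))).2
      - (valAt 0 (homotopyOp i (-1) α) (TensorAlgebra.ι K (x, 0))).2 := by
  simp [homotopyParam, evalAt_eq_valAt]

/-- The map `F ↦ F(w)₀` on `L(V, W)`. -/
noncomputable def applyFst (w : Tens K V₀ V₁) : THom K V₀ V₁ W₀ W₁ →ₗ[K] W₀ :=
  LinearMap.fst K W₀ W₁ ∘ₗ LinearMap.applyₗ w

/-- The map `F ↦ F(w)₁` on `L(V, W)`. -/
noncomputable def applySnd (w : Tens K V₀ V₁) : THom K V₀ V₁ W₀ W₁ →ₗ[K] W₁ :=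
  LinearMap.snd K W₀ W₁ ∘ₗ LinearMap.applyₗ w

variable {V : TwoTermLeibniz K V₀ V₁} {W : TwoTermLeibniz K W₀ W₁}

/-- Vanishing curvature, split by form degree: a family of infinity morphisms and the differential
equation that governs it. -/
theorem InfHomotopy.exists_components [CharZero K] (α : InfHomotopy V W) :
    ∃ (f : K → InfMorphism V W) (β : K → V₀ →ₗ[K] W₁),
      (∀ t, valAt t α.α = (f t).toL) ∧ (∀ t, coeffAt t α.α = ofParam (β t)) ∧
      ∀ t, derivAt t α.α = ofComponents (W.l₁ ∘ₗ β t) (β t ∘ₗ V.l₁)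
        (V.l₂.compr₂ (β t) - W.l₂r.compl₁₂ (f t).f₁₀ (β t) - W.l₂l.compl₁₂ (β t) (f t).f₁₀) := by
  have h₁ (t : K) : ∃ f : InfMorphism V W, f.toL = valAt t α.α :=
    exists_toL_eq (valAt_mem α.degree t) (by rw [← valAt_curvature, α.maurerCartan, map_zero])
  have h₂ (t : K) := eq_ofParam (coeffAt_mem α.degree t)
  choose f hf using h₁
  choose β hβ using h₂
  refine ⟨f, β, fun t => (hf t).symm, hβ, fun t => ?_⟩
  have h := coeffAt_curvature V W t α.α
  rw [α.maurerCartan, map_zero, eq_comm, sub_eq_zero, ← hf, hβ, (f t).toL_eq,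
    twistedDiff_ofComponents_ofParam] at h
  exact h.symm

theorem InfHomotopy.isTwoTermHomotopy [CharZero K] (i : Fin 2) (α : InfHomotopy V W)
    {f g : InfMorphism V W} (hf : valAt 0 α.α = f.toL) (hg : valAt 1 α.α = g.toL) :
    (∀ x, g.f₁₀ x - f.f₁₀ x = W.l₁ (homotopyParam i α.α x)) ∧
    (∀ h, g.f₁₁ h - f.f₁₁ h = homotopyParam i α.α (V.l₁ h)) ∧
    ∀ x y, g.f₂ x y - f.f₂ x y = homotopyParam i α.α (V.l₂ x y)
      - W.l₂r (f.f₁₀ x) (homotopyParam i α.α y) - W.l₂l (homotopyParam i α.α x) (g.f₁₀ y) := by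
  obtain ⟨F, β, hF, hβ, hd⟩ := α.exists_components
  obtain rfl : F 0 = f := InfMorphism.toL_injective ((hF 0).symm.trans hf)
  obtain rfl : F 1 = g := InfMorphism.toL_injective ((hF 1).symm.trans hg)
  -- The primitive of `β` that vanishes at 0. Subtracting the value at 0 removes the integration
  -- constant, the only place where `i` matters.
  let p (t : K) (x : V₀) : W₁ :=
    (valAt t (homotopyOp i (-1) α.α) (TensorAlgebra.ι K (x, 0))).2
      - (valAt 0 (homotopyOp i (-1) α.α) (TensorAlgebra.ι K (x, 0))).2
  have hp₀ (x : V₀) : p 0 x = 0 := sub_self _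
  have hp₁ (x : V₀) : p 1 x = homotopyParam i α.α x := (homotopyParam_apply i α.α x).symm
  have hp (x : V₀) : ((fun t => p t x), (fun t => β t x)) ∈ polyCurves K W₁ := by
    have h := Submodule.sub_mem _
      (polyCurves_map (applySnd (TensorAlgebra.ι K (x, 0)))
        (valAt_mem_polyCurves (homotopyOp i (-1) α.α)))
      (const_mem_polyCurves (K := K)
        (valAt 0 (homotopyOp i (-1) α.α) (TensorAlgebra.ι K (x, 0))).2)
    convert h using 1
    ext t
    · simp [p, applySnd]
    · simp [applySnd, derivAt_homotopyOp, hβ, ofParam_ι]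
  have ha (x : V₀) :
      ((fun t => (F t).f₁₀ x), (fun t => W.l₁ (β t x))) ∈ polyCurves K W₀ := by
    convert polyCurves_map (applyFst (TensorAlgebra.ι K (x, 0))) (valAt_mem_polyCurves α.α) using 1
    ext t <;> simp [applyFst, hF, hd, InfMorphism.toL_eq, ofComponents_ι]
  have hb (h : V₁) :
      ((fun t => (F t).f₁₁ h), (fun t => β t (V.l₁ h))) ∈ polyCurves K W₁ := by
    convert polyCurves_map (applySnd (TensorAlgebra.ι K (0, h))) (valAt_mem_polyCurves α.α) using 1
    ext t <;> simp [applySnd, hF, hd, InfMorphism.toL_eq, ofComponents_ι]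
  have hc (x y : V₀) : ((fun t => (F t).f₂ x y), (fun t => β t (V.l₂ x y)
      - W.l₂r ((F t).f₁₀ x) (β t y) - W.l₂l (β t x) ((F t).f₁₀ y))) ∈ polyCurves K W₁ := by
    convert polyCurves_map (applySnd (TensorAlgebra.ι K (x, 0) * TensorAlgebra.ι K (y, 0)))
      (valAt_mem_polyCurves α.α) using 1
    ext t <;> simp [applySnd, hF, hd, InfMorphism.toL_eq, ofComponents_ι_mul_ι]
  -- Needed at every `t`, not only at 1, since `(F t).f₁₀` enters the equation for `(F t).f₂`.
  have ea (t : K) (x : V₀) : (F t).f₁₀ x = (F 0).f₁₀ x + W.l₁ (p t x) := by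
    have h := Submodule.sub_mem _ (ha x) (polyCurves_map W.l₁ (hp x))
    have h := eq_of_polyCurves_zero (u := fun t => (F t).f₁₀ x - W.l₁ (p t x))
      (by convert h using 1; ext t <;> simp) t 0
    simp only [hp₀, map_zero, sub_zero] at h
    rw [← h, sub_add_cancel]
  refine ⟨fun x => ?_, fun h => ?_, fun x y => ?_⟩
  · rw [ea 1, hp₁, add_sub_cancel_left]
  · have e := Submodule.sub_mem _ (hb h) (hp (V.l₁ h))
    have e := eq_of_polyCurves_zero (u := fun t => (F t).f₁₁ h - p t (V.l₁ h))
      (by convert e using 1; ext t <;> simp) 1 0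
    simp only [hp₀, hp₁, sub_zero] at e
    rw [← e, sub_sub_cancel]
  -- The combination below is constant in `t`. Its last term `W.l₂l (p t x) (W.l₁ (p t y))` is the
  -- primitive of the quadratic part of the equation: `W.rel_b` identifies `W.l₂r (W.l₁ (p t x)) (β
  -- t y)` with one half of the Leibniz rule.
  · have e := Submodule.add_mem _ (Submodule.sub_mem _ (hc x y) (hp (V.l₂ x y)))
      (Submodule.add_mem _ (Submodule.add_mem _ (polyCurves_map (W.l₂r ((F 0).f₁₀ x)) (hp y))
        (polyCurves_map (W.l₂l.flip ((F 0).f₁₀ y)) (hp x)))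
        (polyCurves_map₂ W.l₂l (hp x) (polyCurves_map W.l₁ (hp y))))
    have e := eq_of_polyCurves_zero (u := fun t => (F t).f₂ x y - p t (V.l₂ x y)
        + (W.l₂r ((F 0).f₁₀ x) (p t y) + W.l₂l (p t x) ((F 0).f₁₀ y)
          + W.l₂l (p t x) (W.l₁ (p t y))))
      (by
        convert e using 1
        ext t
        · simp
        · have h₁ := ea t x
          have h₂ := ea t y
          simp only [Prod.snd_add, Prod.snd_sub, Pi.add_apply, Pi.sub_apply, h₁, h₂, map_add,
            LinearMap.add_apply, W.rel_b, LinearMap.flip_apply]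
          abel) 1 0
    simp only [hp₀, hp₁, map_zero, LinearMap.zero_apply, add_zero, sub_zero] at e
    rw [ea 1, hp₁, ← e, map_add]
    abel

/-! ### From 2-term homotopies to infinity homotopies -/

/-- The infinity homotopy `t ↦ f^{tθ} + θ dt` given by a 2-term homotopy `θ` with source `f`. -/
noncomputable def homotopyCurve (f : InfMorphism V W) (θ : V₀ →ₗ[K] W₁) : LForms K V₀ V₁ W₀ W₁ :=
  f.toL ⊗ₜ TrivSqZeroExt.inl 1
    + ofComponents (W.l₁ ∘ₗ θ) (θ ∘ₗ V.l₁)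
      (V.l₂.compr₂ θ - W.l₂r.compl₁₂ f.f₁₀ θ - W.l₂l.compl₁₂ θ f.f₁₀) ⊗ₜ
        TrivSqZeroExt.inl Polynomial.X
    + ofComponents 0 0 (-W.l₂l.compl₁₂ θ (W.l₁ ∘ₗ θ)) ⊗ₜ TrivSqZeroExt.inl (Polynomial.X ^ 2)
    + ofParam θ ⊗ₜ TrivSqZeroExt.inr 1

theorem homotopyCurve_mem [CharZero K] (f : InfMorphism V W) (θ : V₀ →ₗ[K] W₁) :
    homotopyCurve f θ ∈ totDeg K V₀ V₁ W₀ W₁ (-1) :=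
  Submodule.add_mem _ (Submodule.add_mem _ (Submodule.add_mem _
    (val_tmul_mem_totDeg (ofComponents_mem _ _ _) _)
    (val_tmul_mem_totDeg (ofComponents_mem _ _ _) _))
    (val_tmul_mem_totDeg (ofComponents_mem _ _ _) _))
    (coeff_tmul_mem_totDeg (ofParam_mem _) _)

theorem valAt_homotopyCurve [CharZero K] (f : InfMorphism V W) (θ : V₀ →ₗ[K] W₁) (t : K) :
    valAt t (homotopyCurve f θ) = (f.transport (t • θ)).toL := by
  refine convDeg_neg_one_ext (valAt_mem (homotopyCurve_mem f θ) t) (ofComponents_mem _ _ _) ?_ ?_ ?_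
  · intro x
    simp [homotopyCurve, valAt_tmul, InfMorphism.toL_eq, InfMorphism.transport, ofComponents_ι]
  · intro h
    simp [homotopyCurve, valAt_tmul, InfMorphism.toL_eq, InfMorphism.transport, ofComponents_ι]
  · intro x y
    simp [homotopyCurve, valAt_tmul, InfMorphism.toL_eq, InfMorphism.transport,
      ofComponents_ι_mul_ι]
    module

theorem coeffAt_homotopyCurve (f : InfMorphism V W) (θ : V₀ →ₗ[K] W₁) (t : K) :
    coeffAt t (homotopyCurve f θ) = ofParam θ := by
  simp [homotopyCurve, coeffAt_tmul]

/-- The coefficient `2 * t` of the quadratic term matches the two mixed products of `θ` with `W.l₁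
∘ₗ (t • θ)`, which agree by `W.rel_b`. -/
theorem derivAt_homotopyCurve [CharZero K] (f : InfMorphism V W) (θ : V₀ →ₗ[K] W₁) (t : K) :
    derivAt t (homotopyCurve f θ)
      = twistedDiff V W (f.transport (t • θ)).toL (ofParam θ) := by
  have e : derivAt t (homotopyCurve f θ) = ofComponents (W.l₁ ∘ₗ θ) (θ ∘ₗ V.l₁)
      (V.l₂.compr₂ θ - W.l₂r.compl₁₂ f.f₁₀ θ - W.l₂l.compl₁₂ θ f.f₁₀)
      + (2 * t) • ofComponents 0 0 (-W.l₂l.compl₁₂ θ (W.l₁ ∘ₗ θ)) := by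
    simp [homotopyCurve, derivAt_tmul, one_add_one_eq_two]
  rw [e, InfMorphism.toL_eq, twistedDiff_ofComponents_ofParam]
  refine convDeg_neg_one_ext (Submodule.add_mem _ (ofComponents_mem _ _ _)
    (Submodule.smul_mem _ _ (ofComponents_mem _ _ _))) (ofComponents_mem _ _ _) ?_ ?_ ?_
  · intro x
    simp [ofComponents_ι]
  · intro h
    simp [ofComponents_ι]
  · intro x y
    simp [InfMorphism.transport, ofComponents_ι_mul_ι, W.rel_b]
    module

theorem curvature_homotopyCurve [CharZero K] (f : InfMorphism V W) (θ : V₀ →ₗ[K] W₁) :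
    curvature V W (homotopyCurve f θ) = 0 :=
  eq_zero_of_valAt_of_coeffAt
    (fun t => by rw [valAt_curvature, valAt_homotopyCurve, InfMorphism.flatCurvature_toL])
    (fun t => by rw [coeffAt_curvature, valAt_homotopyCurve, coeffAt_homotopyCurve,
      derivAt_homotopyCurve, sub_self])

/-- The primitive of the constant coefficient is `t - i`, and the difference of its values at 1 and
0 is 1 for either `i`. -/
theorem homotopyParam_homotopyCurve [CharZero K] (i : Fin 2) (f : InfMorphism V W)
    (θ : V₀ →ₗ[K] W₁) :
    homotopyParam i (homotopyCurve f θ) = θ := by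
  ext x
  simp [homotopyParam_apply, homotopyCurve, homotopyOp_tmul, valAt_tmul, formH, ofParam_ι,
    primitive_one]
  module

theorem InfMorphism.transport_zero (f : InfMorphism V W) : f.transport 0 = f := by
  apply InfMorphism.toL_injective
  rw [InfMorphism.toL_eq, InfMorphism.toL_eq]
  congr 1 <;> ext <;> simp [InfMorphism.transport]

/-- Conditions (a) and (b) give `g₁`; once `g₁` is inserted in (c), that condition gives `g₂`. -/
theorem TwoTermHomotopy.transport_eq (T : TwoTermHomotopy V W) : T.f.transport T.θ = T.g := by
  apply InfMorphism.toL_injective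
  rw [InfMorphism.toL_eq, InfMorphism.toL_eq]
  congr 1
  · ext x
    simp [InfMorphism.transport, ← T.rel_a]
  · ext x
    simp [InfMorphism.transport, ← T.rel_b]
  · ext x y
    have h : T.f.f₁₀ y + W.l₁ (T.θ y) = T.g.f₁₀ y := by rw [← T.rel_a]; abel
    have h' := T.rel_c x y
    rw [← h] at h'
    rw [sub_eq_iff_eq_add] at h'
    simp only [InfMorphism.transport, LinearMap.add_apply, LinearMap.sub_apply,
      LinearMap.compr₂_apply, LinearMap.compl₁₂_apply, LinearMap.comp_apply, h']
    abel

end Integration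

end LeibInf

/-! ### The main theorem -/

theorem mainTheorem1 {K V₀ V₁ W₀ W₁ : Type*} [Field K] [CharZero K]
    [AddCommGroup V₀] [Module K V₀] [AddCommGroup V₁] [Module K V₁]
    [AddCommGroup W₀] [Module K W₀] [AddCommGroup W₁] [Module K W₁]
    (V : LeibInf.TwoTermLeibniz K V₀ V₁) (W : LeibInf.TwoTermLeibniz K W₀ W₁) (i : Fin 2) :
    ∃ S : LeibInf.InfHomotopy V W → LeibInf.TwoTermHomotopy V W,
      (∀ a, (S a).θ = LeibInf.homotopyParam i a.α) ∧
      (∀ a, a ∈ LeibInf.infHomotopies (S a).f (S a).g) ∧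
      Function.Surjective S ∧
      ∀ f g : LeibInf.InfMorphism V W,
        Set.MapsTo S (LeibInf.infHomotopies f g) (LeibInf.twoTermHomotopies f g) ∧
        Set.SurjOn S (LeibInf.infHomotopies f g) (LeibInf.twoTermHomotopies f g) := by
  open LeibInf in
  have e₀ : (evalAt 0 : LForms K V₀ V₁ W₀ W₁ →ₗ[K] _) = valAt 0 := by simp [evalAt_eq_valAt]
  have e₁ : (evalAt 1 : LForms K V₀ V₁ W₀ W₁ →ₗ[K] _) = valAt 1 := by simp [evalAt_eq_valAt]
  have hex (a : InfHomotopy V W) (t : K) : ∃ f : InfMorphism V W, f.toL = valAt t a.α :=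
    exists_toL_eq (valAt_mem a.degree t) (by rw [← valAt_curvature, a.maurerCartan, map_zero])
  choose F hF using hex
  have hrel (a : InfHomotopy V W) := a.isTwoTermHomotopy i (hF a 0).symm (hF a 1).symm
  let S (a : InfHomotopy V W) : TwoTermHomotopy V W :=
    ⟨F a 0, F a 1, homotopyParam i a.α, (hrel a).1, (hrel a).2.1, (hrel a).2.2⟩
  have hS (a : InfHomotopy V W) : a ∈ infHomotopies (S a).f (S a).g := by
    refine ⟨?_, ?_⟩
    · rw [e₀, ← hF]
    · rw [e₁, ← hF]
  have hmaps (f g : InfMorphism V W) : Set.MapsTo S (infHomotopies f g) (twoTermHomotopies f g) :=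
    fun a ha => ⟨InfMorphism.toL_injective ((hS a).1.symm.trans ha.1),
      InfMorphism.toL_injective ((hS a).2.symm.trans ha.2)⟩
  -- The preimage is the solution with constant `dt` coefficient `T.θ`. Its source and target are
  -- those of `T`, which gives both forms of surjectivity.
  have hsurj (T : TwoTermHomotopy V W) : ∃ a ∈ infHomotopies T.f T.g, S a = T := by
    let a : InfHomotopy V W :=
      ⟨homotopyCurve T.f T.θ, homotopyCurve_mem T.f T.θ, curvature_homotopyCurve T.f T.θ⟩
    have ha : a ∈ infHomotopies T.f T.g := by
      refine ⟨?_, ?_⟩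
      · rw [e₀, valAt_homotopyCurve, zero_smul]
        exact congrArg InfMorphism.toL T.f.transport_zero
      · rw [e₁, valAt_homotopyCurve, one_smul, T.transport_eq]
    refine ⟨a, ha, ?_⟩
    obtain ⟨h₁, h₂⟩ := hmaps _ _ ha
    have h₃ : (S a).θ = T.θ := homotopyParam_homotopyCurve i T.f T.θ
    generalize S a = T' at h₁ h₂ h₃
    cases T
    cases T'
    simp_all
  refine ⟨S, fun _ => rfl, hS, fun T => ?_, fun f g => ⟨hmaps f g, ?_⟩⟩
  · obtain ⟨a, -, ha⟩ := hsurj T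
    exact ⟨a, ha⟩
  · rintro T ⟨rfl, rfl⟩
    obtain ⟨a, ha, hT⟩ := hsurj T
    exact ⟨a, ha, hT⟩
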